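/- Let $A=\{0,1,\#\}$. A \emph{right ideal} of $A^*$ is a set $R\subseteq A^*$ with $RA^*\subseteq R$; it is \emph{essential} if it meets every non-empty right ideal of $A^*$, and \emph{finitely generated} if $R=\Gamma A^*$ for some finite $\Gamma\subseteq A^*$. A \emph{right-ideal isomorphism} is a bijection $\varphi:R_1\to R_2$ between right ideals with $\varphi(xz)=\varphi(x)z$ for all $x\in R_1$, $z\in A^*$; it is \emph{maximal} if it has no strict extension to a right-ideal isomorphism. Every isomorphism $\varphi$ between essential right ideals has a unique maximal extension $\max\varphi$. Let $\mathcal G_{3,1}$ be the group of all maximal isomorphisms between essential right ideals of $A^*$, with product $\varphi\cdot\psi=\max(\varphi\circ\psi)$ ($\psi$ is applied first), and let $G_{3,1}\le\mathcal G_{3,1}$ be the Thompson--Higman group of all maximal isomorphisms between finitely generated essential right ideals. Let $G_{3,1}^{\mathrm{mod}\,3}(0,1)$ be the subgroup of all $\varphi\in G_{3,1}$ such that $\varphi$ and $\varphi^{-1}$ map $\{0,1\}^*$ into $\{0,1\}^*$ (where they are defined) and $|\varphi(x)|\equiv|x|\pmod 3$ for all $x\in\{0,1\}^*$ for which $\varphi(x)$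 is defined. Let $G_{3,1}^{\mathrm{mod}\,3}(0,1;\#)$ be the subgroup of all $\varphi\in G_{3,1}^{\mathrm{mod}\,3}(0,1)$ such that $\varphi$ and $\varphi^{-1}$ are defined everywhere on $\{0,1\}^*\#$ and map $\{0,1\}^*\#$ into itself. For $i\in\{1,2,3\}$ let $\kappa_i\in\mathcal G_{3,1}$ be the (maximal extension of the) map $x\#w\mapsto x'\#w$ for $x\in\{0,1\}^*$, $w\in A^*$, where $x'$ arises from $x=x_0x_1\dots x_{m-1}$ by applying, to the positions of the bits, all the $3$-cycles $(i+3n\mid i+3n+1\mid i+3n+2)$ with $n\ge 0$ and $i+3n+2<m$ (the bit at position $k$ moves to the image of $k$; the first $i$ bits and the at most two remaining bits at the right end stay fixed). Let $\kappa_{321}=\kappa_3\kappa_2\kappa_1$ ($\kappa_1$ is applied first). Within $\mathcal G_{3,1}$ put $$H(0,1)=\langle G_{3,1}^{\mathrm{mod}\,3}(0,1)\cup\{\kappa_{321}\}\rangle,\qquad H(0,1;\#)=\langle G_{3,1}^{\mathrm{mod}\,3}(0,1;\#)\cup\{\kappa_{321}\}\rangle .$$ For a group $G$, a subset $S$ and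 $g\in\langle S\rangle$, let $|g|_S$ be the length of a shortest word over $S\cup S^{-1}$ that represents $g$. For a finitely generated group $K$ with finite generating set $T$ and a finitely generated subgroup $H\le K$ with finite generating set $S$, the distortion function of $H$ in $K$ (relative to $S$, $T$) is $\delta_{S,T}(n)=\max\{|h|_S : h\in H,\ |h|_T\le n\}$. Functions $f_1,f_2:\mathbb N\to\mathbb N$ are \emph{linearly equivalent} if there are positive integers $c_0,\dots,c_4$ such that $f_1(n)\le c_1f_2(c_2n)$ and $f_2(n)\le c_3f_1(c_4n)$ for all $n\ge c_0$. We say that the distortion of $H$ in $K$ is \emph{exponential} if $H\le K$, both groups are finitely generated, and for all finite generating sets $S$ of $H$ and $T$ of $K$ the function $\delta_{S,T}$ is linearly equivalent to $n\mapsto 2^n$. \textbf{Theorem.} (1) The distortion of $G_{3,1}$ in $\langle G_{3,1}\cup\{\kappa_{321}\}\rangle$ is exponential. (2) The distortion of $G_{3,1}^{\mathrm{mod}\,3}(0,1)$ in $H(0,1)$, and in $\langle G_{3,1}\cup\{\kappa_{321}\}\rangle$, is exponential. (3) The distortion of $G_{3,1}^{\mathrm{mod}\,3}(0,1;\#)$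 in $H(0,1;\#)$, in $H(0,1)$, and in $\langle G_{3,1}\cup\{\kappa_{321}\}\rangle$, is exponential. -/

import Mathlib

namespace BigThompson

section General

variable {A : Type*}

/-! ## Right ideals of the free monoid `A*` (words are lists, concatenation is `++`) -/

/-- `R` is a right ideal of `A*`. -/
def IsRightIdeal (R : Set (List A)) : Prop :=
  ∀ x ∈ R, ∀ z : List A, x ++ z ∈ R

/-- `R` meets every (non-empty) right ideal of `A*`. -/
def IsEssential (R : Set (List A)) : Prop :=
  ∀ J : Set (List A), IsRightIdeal J → J.Nonempty → (R ∩ J).Nonempty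

/-- `R = Γ A*` for some finite set `Γ` of words. -/
def IsFinGenRightIdeal (R : Set (List A)) : Prop :=
  ∃ Γ : Set (List A), Γ.Finite ∧ R = {x | ∃ g ∈ Γ, ∃ z : List A, x = g ++ z}

/-- The domain of a partial injective map of words. -/
def domain (φ : List A ≃. List A) : Set (List A) := {x | ∃ y, y ∈ φ x}

/-- The image of a partial injective map of words. -/
def image (φ : List A ≃. List A) : Set (List A) := {y | ∃ x, y ∈ φ x}

/-- A bijection `φ` between two sets of words is a right-ideal isomorphism when `φ(x)` defined
implies that `φ(xz)` is defined and equal to `φ(x)z`. (Domain and image are then right ideals.) -/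
def IsRightIdealIso (φ : List A ≃. List A) : Prop :=
  ∀ x y z : List A, y ∈ φ x → y ++ z ∈ φ (x ++ z)

theorem IsRightIdealIso.domain_ideal {φ : List A ≃. List A} (h : IsRightIdealIso φ) :
    IsRightIdeal (domain φ) := fun x ⟨y, hy⟩ z => ⟨y ++ z, h x y z hy⟩

theorem IsRightIdealIso.image_ideal {φ : List A ≃. List A} (h : IsRightIdealIso φ) :
    IsRightIdeal (image φ) := fun y ⟨x, hx⟩ z => ⟨x ++ z, h x y z hx⟩

theorem isEssential_iff {R : Set (List A)} (hR : IsRightIdeal R) :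
    IsEssential R ↔ ∀ u : List A, ∃ v : List A, u ++ v ∈ R := by
  constructor
  · intro h u
    obtain ⟨x, hx, v, rfl⟩ := h {x | ∃ v, x = u ++ v}
      (by rintro _ ⟨v, rfl⟩ z; exact ⟨v ++ z, by simp⟩) ⟨u, [], by simp⟩
    exact ⟨v, hx⟩
  · rintro h J hJ ⟨u, hu⟩
    obtain ⟨v, hv⟩ := h u
    exact ⟨u ++ v, hv, hJ u hu v⟩

/-- Over a finite alphabet, an essential right ideal is finitely generated iff it contains all
sufficiently long words. -/
theorem isFinGen_iff [Finite A] {R : Set (List A)} (hR : IsRightIdeal R) (hE : IsEssential R) :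
    IsFinGenRightIdeal R ↔ ∃ N : ℕ, ∀ x : List A, N ≤ x.length → x ∈ R := by
  constructor
  · rintro ⟨Γ, hΓ, rfl⟩
    obtain ⟨N, hN⟩ := (hΓ.image List.length).bddAbove
    refine ⟨N, fun x hx => ?_⟩
    obtain ⟨v, g, hg, z, hz⟩ := (isEssential_iff hR).1 hE x
    have hgl : g.length ≤ N := hN ⟨g, hg, rfl⟩
    have h1 : g <+: x :=
      List.prefix_of_prefix_length_le ⟨z, hz.symm⟩ ⟨v, rfl⟩ (hgl.trans hx)
    obtain ⟨t, ht⟩ := h1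
    exact ⟨g, hg, t, ht.symm⟩
  · rintro ⟨N, hN⟩
    refine ⟨{x | x ∈ R ∧ x.length ≤ N}, ?_, ?_⟩
    · exact (List.finite_length_le A N).subset fun x hx => hx.2
    · ext x
      constructor
      · intro hx
        by_cases hl : x.length ≤ N
        · exact ⟨x, ⟨hx, hl⟩, [], by simp⟩
        · refine ⟨x.take N, ⟨hN _ ?_, ?_⟩, x.drop N, by simp⟩ <;> simp <;> omega
      · rintro ⟨g, ⟨hg, -⟩, z, rfl⟩
        exact hR g hg z

/-! ## The Thompson-Higman group of all maximal isomorphisms between essential right ideals -/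

variable (A) in
/-- A right-ideal isomorphism between essential right ideals of `A*`. -/
structure EssIso where
  /-- the underlying partial injective map -/
  map : List A ≃. List A
  iso : IsRightIdealIso map
  ess_domain : IsEssential (domain map)
  ess_image : IsEssential (image map)

/-- `φ` has no strict extension to a right-ideal isomorphism. (The order of partial equivalences
is extension.) -/
def IsMaximalIso (φ : List A ≃. List A) : Prop :=
  ∀ Φ : List A ≃. List A, IsRightIdealIso Φ → φ ≤ Φ → Φ = φ

variable (A) in
/-- The elements of the big Thompson-Higman group over the alphabet `A`: the maximal isomorphisms
between essential right ideals of `A*`. -/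
structure BigG extends EssIso A where
  maximal : IsMaximalIso map

theorem BigG.ext {f g : BigG A} (h : f.map = g.map) : f = g := by
  obtain ⟨⟨f, _, _, _⟩, _⟩ := f
  obtain ⟨⟨g, _, _, _⟩, _⟩ := g
  cases h
  rfl

open Classical in
/-- The partial injective map whose graph is a given single-valued and injective relation. -/
noncomputable def pequivOfRel (r : List A → List A → Prop)
    (hf : ∀ x y y', r x y → r x y' → y = y') (hi : ∀ x x' y, r x y → r x' y → x = x') :
    List A ≃. List A :=
  { toFun := fun x => if h : ∃ y, r x y then some h.choose else none
    invFun := fun y => if h : ∃ x, r x y then some h.choose else none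
    inv := by
      intro x y
      have h1 : (x ∈ if h : ∃ x, r x y then some h.choose else none) ↔ r x y := by
        split_ifs with h
        · rw [Option.mem_some_iff]
          exact ⟨fun e => e ▸ h.choose_spec, fun e => hi _ _ _ h.choose_spec e⟩
        · exact ⟨fun e => by simp at e, fun e => (h ⟨x, e⟩).elim⟩
      have h2 : (y ∈ if h : ∃ y, r x y then some h.choose else none) ↔ r x y := by
        split_ifs with h
        · rw [Option.mem_some_iff]
          exact ⟨fun e => e ▸ h.choose_spec, fun e => hf _ _ _ h.choose_spec e⟩
        · exact ⟨fun e => by simp at e, fun e => (h ⟨y, e⟩).elim⟩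
      exact h1.trans h2.symm }

open Classical in
theorem mem_pequivOfRel {r : List A → List A → Prop}
    {hf : ∀ x y y', r x y → r x y' → y = y'} {hi : ∀ x x' y, r x y → r x' y → x = x'}
    {x y : List A} : y ∈ pequivOfRel r hf hi x ↔ r x y := by
  change (y ∈ dite _ _ _) ↔ _
  split_ifs with h
  · rw [Option.mem_some_iff]
    exact ⟨fun e => e ▸ h.choose_spec, fun e => hf _ _ _ h.choose_spec e⟩
  · exact ⟨fun e => by simp at e, fun e => (h ⟨y, e⟩).elim⟩

namespace EssIso

theorem exists_domain (φ : EssIso A) (u : List A) : ∃ v w, w ∈ φ.map (u ++ v) := by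
  obtain ⟨v, w, h⟩ := (isEssential_iff φ.iso.domain_ideal).1 φ.ess_domain u
  exact ⟨v, w, h⟩

theorem exists_image (φ : EssIso A) (u : List A) : ∃ v w, u ++ v ∈ φ.map w := by
  obtain ⟨v, w, h⟩ := (isEssential_iff φ.iso.image_ideal).1 φ.ess_image u
  exact ⟨v, w, h⟩

/-- `x ↦ y` belongs to the maximum extension of `φ` iff it is compatible with `φ` on all
right multiples. -/
def Compat (φ : EssIso A) (x y : List A) : Prop :=
  ∀ z : List A, (∀ w, w ∈ φ.map (x ++ z) → w = y ++ z) ∧ (∀ w, y ++ z ∈ φ.map w → w = x ++ z)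

/-- The underlying map of the maximum extension of `φ`. -/
noncomputable def maxMap (φ : EssIso A) : List A ≃. List A :=
  pequivOfRel φ.Compat
    (by
      intro x y y' h h'
      obtain ⟨v, w, hw⟩ := φ.exists_domain x
      have := ((h v).1 w hw).symm.trans ((h' v).1 w hw)
      exact List.append_cancel_right this)
    (by
      intro x x' y h h'
      obtain ⟨v, w, hw⟩ := φ.exists_image y
      have := ((h v).2 w hw).symm.trans ((h' v).2 w hw)
      exact List.append_cancel_right this)

theorem mem_maxMap {φ : EssIso A} {x y : List A} : y ∈ φ.maxMap x ↔ φ.Compat x y :=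
  mem_pequivOfRel

theorem maxMap_iso (φ : EssIso A) : IsRightIdealIso φ.maxMap := by
  intro x y z h
  rw [mem_maxMap] at *
  intro t
  simpa using h (z ++ t)

/-- Every right-ideal isomorphism that extends `φ` is a restriction of `φ.maxMap`. -/
theorem le_maxMap_of_le {φ : EssIso A} {Φ : List A ≃. List A} (hΦ : IsRightIdealIso Φ)
    (h : φ.map ≤ Φ) : Φ ≤ φ.maxMap := by
  intro x y hy
  rw [mem_maxMap]
  intro z
  have hz := hΦ x y z hy
  exact ⟨fun w hw => Option.mem_unique (h _ _ hw) hz,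
    fun w hw => Φ.inj (h _ _ hw) hz⟩

theorem map_le_maxMap (φ : EssIso A) : φ.map ≤ φ.maxMap := le_maxMap_of_le φ.iso le_rfl

/-- The maximum extension of an isomorphism between essential right ideals. -/
noncomputable def maxExt (φ : EssIso A) : BigG A where
  map := φ.maxMap
  iso := φ.maxMap_iso
  ess_domain := by
    rw [isEssential_iff φ.maxMap_iso.domain_ideal]
    intro u
    obtain ⟨v, w, h⟩ := φ.exists_domain u
    exact ⟨v, w, φ.map_le_maxMap _ _ h⟩
  ess_image := by
    rw [isEssential_iff φ.maxMap_iso.image_ideal]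
    intro u
    obtain ⟨v, w, h⟩ := φ.exists_image u
    exact ⟨v, w, φ.map_le_maxMap _ _ h⟩
  maximal := fun _ hΦ h =>
    le_antisymm (le_maxMap_of_le hΦ (φ.map_le_maxMap.trans h)) h

theorem eq_maxExt {φ : EssIso A} {f : BigG A} (h : φ.map ≤ f.map) : f = φ.maxExt :=
  BigG.ext (f.maximal _ φ.maxMap_iso (le_maxMap_of_le f.iso h)).symm

/-- The composition: `ψ` is applied first, then `φ`. -/
def comp (φ ψ : EssIso A) : EssIso A where
  map := ψ.map.trans φ.map
  iso := by
    intro x y z h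
    rw [PEquiv.mem_trans] at *
    obtain ⟨b, h1, h2⟩ := h
    exact ⟨b ++ z, ψ.iso _ _ _ h1, φ.iso _ _ _ h2⟩
  ess_domain := by
    rw [isEssential_iff]
    · intro u
      obtain ⟨v, w, h⟩ := ψ.exists_domain u
      obtain ⟨v', w', h'⟩ := φ.exists_domain w
      refine ⟨v ++ v', w', (PEquiv.mem_trans _ _ _ _).2 ⟨w ++ v', ?_, h'⟩⟩
      simpa using ψ.iso _ _ v' h
    · rintro x ⟨y, h⟩ z
      rw [PEquiv.mem_trans] at h
      obtain ⟨b, h1, h2⟩ := h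
      exact ⟨y ++ z, (PEquiv.mem_trans _ _ _ _).2 ⟨b ++ z, ψ.iso _ _ _ h1, φ.iso _ _ _ h2⟩⟩
  ess_image := by
    rw [isEssential_iff]
    · intro u
      obtain ⟨v, w, h⟩ := φ.exists_image u
      obtain ⟨v', w', h'⟩ := ψ.exists_image w
      refine ⟨v ++ v', w', (PEquiv.mem_trans _ _ _ _).2 ⟨w ++ v', h', ?_⟩⟩
      simpa using φ.iso _ _ v' h
    · rintro y ⟨x, h⟩ z
      rw [PEquiv.mem_trans] at h
      obtain ⟨b, h1, h2⟩ := h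
      exact ⟨x ++ z, (PEquiv.mem_trans _ _ _ _).2 ⟨b ++ z, ψ.iso _ _ _ h1, φ.iso _ _ _ h2⟩⟩

end EssIso

namespace BigG

/-- The product is the maximum extension of the composition (the right factor acts first). -/
noncomputable instance : Mul (BigG A) := ⟨fun f g => (f.toEssIso.comp g.toEssIso).maxExt⟩

instance : One (BigG A) := ⟨
  { map := PEquiv.refl _
    iso := by
      intro x y z h
      have h : x = y := by simpa using h
      simp [h]
    ess_domain := fun J _ ⟨x, hx⟩ => ⟨x, ⟨x, by simp⟩, hx⟩
    ess_image := fun J _ ⟨x, hx⟩ => ⟨x, ⟨x, by simp⟩, hx⟩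
    maximal := by
      intro Φ _ h
      refine le_antisymm (fun x y hy => ?_) h
      have hx : x ∈ Φ x := h x x (by simp)
      have : x = y := Option.mem_unique hx hy
      simp [this] }⟩

instance : Inv (BigG A) := ⟨fun f =>
  { map := f.map.symm
    iso := by
      intro x y z h
      rw [PEquiv.mem_iff_mem] at *
      exact f.iso _ _ _ h
    ess_domain := by
      have : domain f.map.symm = image f.map := by
        ext x; simp only [domain, image, Set.mem_ofPred_eq, PEquiv.mem_iff_mem]
      rw [this]; exact f.ess_image
    ess_image := by
      have : image f.map.symm = domain f.map := by
        ext x; simp only [domain, image, Set.mem_ofPred_eq, PEquiv.mem_iff_mem]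
      rw [this]; exact f.ess_domain
    maximal := by
      intro Φ hΦ h
      have := f.maximal Φ.symm
        (by intro x y z h; rw [PEquiv.mem_iff_mem] at *; exact hΦ _ _ _ h)
        (by intro x y hy; rw [PEquiv.mem_iff_mem]; exact h _ _ ((PEquiv.mem_iff_mem _).2 hy))
      rw [← this, PEquiv.symm_symm] }⟩

theorem mem_inv {f : BigG A} {x y : List A} : y ∈ f⁻¹.map x ↔ x ∈ f.map y :=
  PEquiv.mem_iff_mem f.map

theorem mem_one {x y : List A} : y ∈ (1 : BigG A).map x ↔ x = y := by
  change y ∈ PEquiv.refl _ x ↔ _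
  simp

theorem mem_mul {f g : BigG A} {x y z : List A} (h : y ∈ g.map x) (h' : z ∈ f.map y) :
    z ∈ (f * g).map x :=
  EssIso.map_le_maxMap _ _ _ ((PEquiv.mem_trans _ _ _ _).2 ⟨y, h, h'⟩)

/-- An element that extends the composition of `g` and `f` is the product. -/
theorem eq_mul {f g k : BigG A}
    (h : ∀ x y z, y ∈ g.map x → z ∈ f.map y → z ∈ k.map x) : k = f * g :=
  EssIso.eq_maxExt (φ := f.toEssIso.comp g.toEssIso) (by
    intro x z hz
    obtain ⟨y, h1, h2⟩ := (PEquiv.mem_trans _ _ _ _).1 hz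
    exact h x y z h1 h2)

noncomputable instance : Group (BigG A) where
  mul_assoc f g k := by
    have h1 := EssIso.eq_maxExt (φ := f.toEssIso.comp (g.toEssIso.comp k.toEssIso))
      (f := f * g * k) (by
        intro x z hz
        obtain ⟨y, h1, h2⟩ := (PEquiv.mem_trans _ _ _ _).1 hz
        obtain ⟨w, h3, h4⟩ := (PEquiv.mem_trans _ _ _ _).1 h1
        exact mem_mul h3 (mem_mul h4 h2))
    have h2 := EssIso.eq_maxExt (φ := f.toEssIso.comp (g.toEssIso.comp k.toEssIso))
      (f := f * (g * k)) (by
        intro x z hz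
        obtain ⟨y, h1, h2⟩ := (PEquiv.mem_trans _ _ _ _).1 hz
        obtain ⟨w, h3, h4⟩ := (PEquiv.mem_trans _ _ _ _).1 h1
        exact mem_mul (mem_mul h3 h4) h2)
    exact h1.trans h2.symm
  one_mul f := (eq_mul (by
    intro x y z h h'
    rw [mem_one] at h'
    exact h' ▸ h)).symm
  mul_one f := (eq_mul (by
    intro x y z h h'
    rw [mem_one] at h
    exact h ▸ h')).symm
  inv_mul_cancel f := (eq_mul (by
    intro x y z h h'
    rw [mem_inv] at h'
    rw [mem_one]
    exact f.map.inj h h')).symm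

theorem mul_cases {f g : BigG A} {x y z w v : List A} (h : y ∈ (f * g).map x)
    (h1 : w ∈ g.map (x ++ z)) (h2 : v ∈ f.map w) : v = y ++ z :=
  Option.mem_unique (mem_mul h1 h2) ((f * g).iso x y z h)

end BigG

variable (A) in
/-- The Thompson-Higman group `G_{N,1}` over a finite alphabet `A` with `N` letters: the maximal
isomorphisms between finitely generated essential right ideals. -/
def thompsonHigman [Finite A] : Subgroup (BigG A) where
  carrier := {f | IsFinGenRightIdeal (domain f.map) ∧ IsFinGenRightIdeal (image f.map)}
  one_mem' := by
    constructor <;>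
    exact ⟨{[]}, Set.finite_singleton _, by
      ext x; simp only [domain, image, Set.mem_ofPred_eq, BigG.mem_one]; simp⟩
  inv_mem' := by
    rintro f ⟨h1, h2⟩
    have e1 : domain f⁻¹.map = image f.map := by
      ext x; simp only [domain, image, Set.mem_ofPred_eq, BigG.mem_inv]
    have e2 : image f⁻¹.map = domain f.map := by
      ext x; simp only [domain, image, Set.mem_ofPred_eq, BigG.mem_inv]
    exact ⟨e1 ▸ h2, e2 ▸ h1⟩
  mul_mem' := by
    rintro f g ⟨hf1, hf2⟩ ⟨hg1, hg2⟩
    rw [isFinGen_iff f.iso.domain_ideal f.ess_domain] at hf1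
    rw [isFinGen_iff f.iso.image_ideal f.ess_image] at hf2
    rw [isFinGen_iff g.iso.domain_ideal g.ess_domain] at hg1
    rw [isFinGen_iff g.iso.image_ideal g.ess_image] at hg2
    obtain ⟨M1, hM1⟩ := hf1
    obtain ⟨M2, hM2⟩ := hf2
    obtain ⟨N1, hN1⟩ := hg1
    obtain ⟨N2, hN2⟩ := hg2
    constructor
    · refine (isFinGen_iff (f * g).iso.domain_ideal (f * g).ess_domain).2
        ⟨N1 + M1, fun x hx => ?_⟩
      obtain ⟨y, hy⟩ := hN1 (x.take N1) (by simp; omega)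
      have hy2 := g.iso _ _ (x.drop N1) hy
      rw [List.take_append_drop] at hy2
      obtain ⟨z, hz⟩ := hM1 (y ++ x.drop N1) (by simp; omega)
      exact ⟨z, BigG.mem_mul hy2 hz⟩
    · refine (isFinGen_iff (f * g).iso.image_ideal (f * g).ess_image).2
        ⟨M2 + N2, fun x hx => ?_⟩
      obtain ⟨y, hy⟩ := hM2 (x.take M2) (by simp; omega)
      have hy2 := f.iso _ _ (x.drop M2) hy
      rw [List.take_append_drop] at hy2
      obtain ⟨z, hz⟩ := hN2 (y ++ x.drop M2) (by simp; omega)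
      exact ⟨z, BigG.mem_mul hz hy2⟩

end General

/-! ## The alphabet `{0,1,#}` -/

/-- The three-letter alphabet `{0,1,#}`: the bits are `some false`, `some true`, and `#` is
`none`. -/
abbrev Letter : Type := Option Bool

/-- The group of all maximal isomorphisms between essential right ideals of `{0,1,#}*`. -/
abbrev BigG31 : Type := BigG Letter

/-- The Thompson-Higman group `G_{3,1}`. -/
def G31 : Subgroup BigG31 := thompsonHigman Letter

/-- A word over `{0,1}` as a word over `{0,1,#}`. -/
def bits (b : List Bool) : List Letter := b.map some

/-- The set `{0,1}*` of words over `{0,1,#}`. -/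
def binaryWords : Set (List Letter) := Set.range bits

/-- The set `{0,1}*#`. -/
def hashedWords : Set (List Letter) := {x | ∃ b, x = bits b ++ [none]}

theorem mem_binaryWords {x : List Letter} : x ∈ binaryWords ↔ ∀ a ∈ x, a ≠ none := by
  constructor
  · rintro ⟨b, rfl⟩ a ha
    simp only [bits, List.mem_map] at ha
    obtain ⟨c, -, rfl⟩ := ha
    simp
  · intro h
    induction x with
    | nil => exact ⟨[], rfl⟩
    | cons a t ih =>
      obtain ⟨b, hb⟩ := ih fun a ha => h a (List.mem_cons_of_mem _ ha)
      cases a with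
      | none => exact absurd rfl (h none (by simp))
      | some c => exact ⟨c :: b, by rw [← hb]; rfl⟩

theorem append_mem_binaryWords {x y : List Letter} :
    x ++ y ∈ binaryWords ↔ x ∈ binaryWords ∧ y ∈ binaryWords := by
  simp only [mem_binaryWords, List.mem_append]
  exact ⟨fun h => ⟨fun a ha => h a (Or.inl ha), fun a ha => h a (Or.inr ha)⟩,
    fun h a ha => ha.elim (h.1 a) (h.2 a)⟩

theorem exists_binary_continuation {f g : BigG31} (hf : f ∈ G31) (hg : g ∈ G31)
    (x : List Letter) :
    ∃ z ∈ binaryWords, ∃ w v, w ∈ g.map (x ++ z) ∧ v ∈ f.map w := by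
  obtain ⟨M, hM⟩ := (isFinGen_iff f.iso.domain_ideal f.ess_domain).1 hf.1
  obtain ⟨N, hN⟩ := (isFinGen_iff g.iso.domain_ideal g.ess_domain).1 hg.1
  have hr : ∀ n, bits (List.replicate n false) ∈ binaryWords := fun n => ⟨_, rfl⟩
  obtain ⟨w, hw⟩ := hN (x ++ bits (List.replicate N false)) (by simp [bits])
  obtain ⟨v, hv⟩ := hM (w ++ bits (List.replicate M false)) (by simp [bits])
  refine ⟨bits (List.replicate N false) ++ bits (List.replicate M false),
    append_mem_binaryWords.2 ⟨hr _, hr _⟩, _, v, ?_, hv⟩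
  rw [← List.append_assoc]
  exact g.iso _ _ _ hw

/-- `G_{3,1}^{mod 3}(0,1)`: the elements `f` of `G_{3,1}` such that `f` and its inverse map
`{0,1}*` into itself (where they are defined) and `|f(x)| ≡ |x| mod 3` for all binary words `x` in
the domain of `f`. -/
def G31mod : Subgroup BigG31 where
  carrier := {f | f ∈ G31 ∧
    (∀ x ∈ binaryWords, ∀ y ∈ f.map x, y ∈ binaryWords) ∧
    (∀ x ∈ binaryWords, ∀ y ∈ f⁻¹.map x, y ∈ binaryWords) ∧
    ∀ x ∈ binaryWords, ∀ y ∈ f.map x, y.length ≡ x.length [MOD 3]}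
  one_mem' := by
    refine ⟨one_mem _, ?_, ?_, ?_⟩
    · intro x hx y hy
      rw [BigG.mem_one] at hy
      exact hy ▸ hx
    · intro x hx y hy
      rw [inv_one, BigG.mem_one] at hy
      exact hy ▸ hx
    · intro x hx y hy
      rw [BigG.mem_one] at hy
      rw [hy]
  inv_mem' := by
    rintro f ⟨h0, h1, h2, h3⟩
    refine ⟨inv_mem h0, h2, by rwa [inv_inv], fun x hx y hy => ?_⟩
    exact (h3 y (h2 x hx y hy) x (BigG.mem_inv.1 hy)).symm
  mul_mem' := by
    have key : ∀ f g : BigG31, f ∈ G31 → g ∈ G31 →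
        (∀ x ∈ binaryWords, ∀ y ∈ f.map x, y ∈ binaryWords) →
        (∀ x ∈ binaryWords, ∀ y ∈ g.map x, y ∈ binaryWords) →
        ∀ x ∈ binaryWords, ∀ y ∈ (f * g).map x, y ∈ binaryWords := by
      intro f g hf hg h1 h2 x hx y hy
      obtain ⟨z, hz, w, v, hw, hv⟩ := exists_binary_continuation hf hg x
      have e := BigG.mul_cases hy hw hv
      have := h1 w (h2 _ (append_mem_binaryWords.2 ⟨hx, hz⟩) w hw) v hv
      rw [e] at this
      exact (append_mem_binaryWords.1 this).1
    rintro f g ⟨hf0, hf1, hf2, hf3⟩ ⟨hg0, hg1, hg2, hg3⟩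
    refine ⟨mul_mem hf0 hg0, key f g hf0 hg0 hf1 hg1, ?_, ?_⟩
    · rw [mul_inv_rev]
      exact key _ _ (inv_mem hg0) (inv_mem hf0) hg2 hf2
    · intro x hx y hy
      obtain ⟨z, hz, w, v, hw, hv⟩ := exists_binary_continuation hf0 hg0 x
      have e := BigG.mul_cases hy hw hv
      have hxz := append_mem_binaryWords.2 ⟨hx, hz⟩
      have := (hf3 w (hg1 _ hxz w hw) v hv).trans (hg3 _ hxz w hw)
      rw [e, List.length_append, List.length_append] at this
      exact Nat.ModEq.add_right_cancel' _ this

/-- `G_{3,1}^{mod 3}(0,1;#)`: the elements `f` of `G_{3,1}^{mod 3}(0,1)` such that `f` and its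
inverse are defined everywhere on `{0,1}*#` and map `{0,1}*#` into itself. -/
def G31modHash : Subgroup BigG31 where
  carrier := {f | f ∈ G31mod ∧
    (∀ x ∈ hashedWords, ∃ y ∈ hashedWords, y ∈ f.map x) ∧
    (∀ x ∈ hashedWords, ∃ y ∈ hashedWords, y ∈ f⁻¹.map x)}
  one_mem' := by
    refine ⟨one_mem _, fun x hx => ⟨x, hx, BigG.mem_one.2 rfl⟩, fun x hx => ⟨x, hx, ?_⟩⟩
    rw [inv_one]
    exact BigG.mem_one.2 rfl
  inv_mem' := by
    rintro f ⟨h0, h1, h2⟩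
    exact ⟨inv_mem h0, h2, by rwa [inv_inv]⟩
  mul_mem' := by
    rintro f g ⟨hf0, hf1, hf2⟩ ⟨hg0, hg1, hg2⟩
    refine ⟨mul_mem hf0 hg0, fun x hx => ?_, fun x hx => ?_⟩
    · obtain ⟨y, hy, h⟩ := hg1 x hx
      obtain ⟨z, hz, h'⟩ := hf1 y hy
      exact ⟨z, hz, BigG.mem_mul h h'⟩
    · obtain ⟨y, hy, h⟩ := hf2 x hx
      obtain ⟨z, hz, h'⟩ := hg2 y hy
      rw [mul_inv_rev]
      exact ⟨z, hz, BigG.mem_mul h h'⟩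

/-! ## The elements `κ_i` -/

/-- Apply the cycles `(0|1|2) (3|4|5) ... (3n|3n+1|3n+2) ...` to the positions of a bit string,
moving the bit at position `k` to the image of `k`; one or two remaining bits at the right end
stay fixed. -/
def rot : List Bool → List Bool
  | a :: b :: c :: t => c :: a :: b :: rot t
  | t => t

/-- The inverse of `rot`. -/
def rotInv : List Bool → List Bool
  | a :: b :: c :: t => b :: c :: a :: rotInv t
  | t => t

theorem rotInv_rot (l : List Bool) : rotInv (rot l) = l := by
  induction l using rot.induct with
  | case1 a b c t ih => simp [rot, rotInv, ih]
  | case2 t h =>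
    rw [rot]
    · rw [rotInv]
      exact h
    · exact h

theorem rot_rotInv (l : List Bool) : rot (rotInv l) = l := by
  induction l using rot.induct with
  | case1 a b c t ih => simp [rot, rotInv, ih]
  | case2 t h =>
    rw [rotInv]
    · rw [rot]
      exact h
    · exact h

/-- The permutation of the bits of a bit string by the cycles `(i+3n | i+3n+1 | i+3n+2)`, `n ≥ 0`,
as far as they fit into the string: the first `i` bits stay fixed, and so do the one or two extra
bits at the right end. -/
def kappaBits (i : ℕ) (b : List Bool) : List Bool := b.take i ++ rot (b.drop i)

/-- The inverse of `kappaBits i`. -/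
def kappaBitsInv (i : ℕ) (b : List Bool) : List Bool := b.take i ++ rotInv (b.drop i)

theorem kappaBitsInv_kappaBits (i : ℕ) (b : List Bool) : kappaBitsInv i (kappaBits i b) = b := by
  induction i generalizing b with
  | zero => simp [kappaBits, kappaBitsInv, rotInv_rot]
  | succ i ih =>
    cases b with
    | nil => simp [kappaBits, kappaBitsInv, rot, rotInv]
    | cons a t => simpa [kappaBits, kappaBitsInv] using ih t

theorem kappaBits_kappaBitsInv (i : ℕ) (b : List Bool) : kappaBits i (kappaBitsInv i b) = b := by
  induction i generalizing b with
  | zero => simp [kappaBits, kappaBitsInv, rot_rotInv]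
  | succ i ih =>
    cases b with
    | nil => simp [kappaBits, kappaBitsInv, rot, rotInv]
    | cons a t => simpa [kappaBits, kappaBitsInv] using ih t

theorem bits_append_inj {b b' : List Bool} {w w' : List Letter}
    (h : bits b ++ none :: w = bits b' ++ none :: w') : b = b' ∧ w = w' := by
  induction b generalizing b' with
  | nil =>
    cases b' with
    | nil => simpa [bits] using h
    | cons c t => simp [bits] at h
  | cons a s ih =>
    cases b' with
    | nil => simp [bits] at h
    | cons c t =>
      simp only [bits, List.map_cons, List.cons_append, List.cons.injEq, Option.some.injEq] at h
      obtain ⟨h1, h2⟩ := ih h.2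
      exact ⟨by rw [h.1, h1], h2⟩

theorem exists_bits_hash (u : List Letter) : ∃ b v w, u ++ v = bits b ++ none :: w := by
  induction u with
  | nil => exact ⟨[], [none], [], rfl⟩
  | cons a t ih =>
    cases a with
    | none => exact ⟨[], [], t, by simp [bits]⟩
    | some c =>
      obtain ⟨b, v, w, h⟩ := ih
      exact ⟨c :: b, v, w, by simp [bits, h]⟩

/-- The graph of `x # w ↦ κ_i(x) # w` where `x` is a word over `{0,1}` and `w` is a word
over `{0,1,#}`. -/
def KappaRel (i : ℕ) (x y : List Letter) : Prop :=
  ∃ (b : List Bool) (w : List Letter),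
    x = bits b ++ none :: w ∧ y = bits (kappaBits i b) ++ none :: w

theorem kappaRel_unique (i : ℕ) (x y y' : List Letter) :
    KappaRel i x y → KappaRel i x y' → y = y' := by
  rintro ⟨b, w, rfl, rfl⟩ ⟨b', w', h, rfl⟩
  obtain ⟨rfl, rfl⟩ := bits_append_inj h
  rfl

theorem kappaRel_injective (i : ℕ) (x x' y : List Letter) :
    KappaRel i x y → KappaRel i x' y → x = x' := by
  rintro ⟨b, w, rfl, rfl⟩ ⟨b', w', rfl, h⟩
  obtain ⟨h1, rfl⟩ := bits_append_inj h
  rw [← kappaBitsInv_kappaBits i b, h1, kappaBitsInv_kappaBits]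

/-- `κ_i` as an isomorphism from the essential right ideal `{0,1}*#{0,1,#}*` onto itself. -/
noncomputable def kappaIso (i : ℕ) : EssIso Letter where
  map := pequivOfRel (KappaRel i) (kappaRel_unique i) (kappaRel_injective i)
  iso := by
    intro x y z h
    rw [mem_pequivOfRel] at *
    obtain ⟨b, w, rfl, rfl⟩ := h
    exact ⟨b, w ++ z, by simp, by simp⟩
  ess_domain := by
    rintro J hJ ⟨u, hu⟩
    obtain ⟨b, v, w, h⟩ := exists_bits_hash u
    exact ⟨u ++ v, ⟨_, mem_pequivOfRel.2 ⟨b, w, h, rfl⟩⟩, hJ u hu v⟩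
  ess_image := by
    rintro J hJ ⟨u, hu⟩
    obtain ⟨b, v, w, h⟩ := exists_bits_hash u
    exact ⟨u ++ v, ⟨_, mem_pequivOfRel.2 ⟨kappaBitsInv i b, w, rfl,
      by rw [kappaBits_kappaBitsInv, h]⟩⟩, hJ u hu v⟩

theorem mem_kappaIso {i : ℕ} {x y : List Letter} : y ∈ (kappaIso i).map x ↔ KappaRel i x y :=
  mem_pequivOfRel (hf := kappaRel_unique i) (hi := kappaRel_injective i)

/-- The element `κ_i` of the big Thompson-Higman group over `{0,1,#}`. -/
noncomputable def kappa (i : ℕ) : BigG31 := (kappaIso i).maxExt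

/-- `κ_321 = κ_3 κ_2 κ_1` (with `κ_1` acting first). -/
noncomputable def kappa321 : BigG31 := kappa 3 * kappa 2 * kappa 1

/-- The subgroup generated by `G` and `κ_321`. -/
noncomputable def adjoinKappa (G : Subgroup BigG31) : Subgroup BigG31 :=
  Subgroup.closure ((G : Set BigG31) ∪ {kappa321})

/-- `H(0,1)`, generated by `G_{3,1}^{mod 3}(0,1)` and `κ_321`. -/
noncomputable def H01 : Subgroup BigG31 := adjoinKappa G31mod

/-- `H(0,1;#)`, generated by `G_{3,1}^{mod 3}(0,1;#)` and `κ_321`. -/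
noncomputable def H01Hash : Subgroup BigG31 := adjoinKappa G31modHash

/-! ## Word length, distortion, linear equivalence -/

section Distortion

variable {G : Type*} [Group G]

/-- The word length of `g` over `S`: the length of a shortest word over `S ∪ S⁻¹` whose product
is `g` (meaningful for `g` in the subgroup generated by `S`). -/
noncomputable def wordLength (S : Set G) (g : G) : ℕ :=
  sInf {n | ∃ l : List G, l.length = n ∧ (∀ s ∈ l, s ∈ S ∨ s⁻¹ ∈ S) ∧ l.prod = g}

/-- The distortion function of the subgroup generated by `S` in the group generated by `T`: it maps
`n` to the largest word length over `S` of an element of the subgroup generated by `S` that has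
word length at most `n` over `T`. (For finite `T` only finitely many elements compete.) -/
noncomputable def distortion (S T : Set G) (n : ℕ) : ℕ :=
  sSup {m | ∃ g ∈ Subgroup.closure S, wordLength T g ≤ n ∧ wordLength S g = m}

/-- Linear equivalence of functions on the natural numbers. -/
def LinearlyEquivalent (f₁ f₂ : ℕ → ℕ) : Prop :=
  ∃ c₀ c₁ c₂ c₃ c₄ : ℕ, 0 < c₀ ∧ 0 < c₁ ∧ 0 < c₂ ∧ 0 < c₃ ∧ 0 < c₄ ∧
    ∀ n ≥ c₀, f₁ n ≤ c₁ * f₂ (c₂ * n) ∧ f₂ n ≤ c₃ * f₁ (c₄ * n)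

/-- The distortion of `H` in `K` is exponential: `H` is a subgroup of `K`, both are finitely
generated, and for all finite generating sets `S` of `H` and `T` of `K` the distortion function is
linearly equivalent to `2^n`. -/
def ExponentialDistortion (H K : Subgroup G) : Prop :=
  H ≤ K ∧ H.FG ∧ K.FG ∧
    ∀ S T : Set G, S.Finite → T.Finite → Subgroup.closure S = H → Subgroup.closure T = K →
      LinearlyEquivalent (distortion S T) (fun n => 2 ^ n)

end Distortion

end BigThompson

/-! Both bounds measure an element of the Thompson-Higman group by the tree of words at which it is
undefined.

Lower bound. `κ_1`, `κ_2`, `κ_3` pass the bit at position `3k+1` on to `3k+2`, `3k+3`, `3k+4`, so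
conjugating the flip of the second bit by `κ_321^n` gives an element `farFlip n` that flips the bit
at position `3n+1` of every long enough bit string followed by `#`. It lies in the smallest group
`G31modHash`, and its length in the group with `κ_321` is linear in `n`. It is undefined at every
binary word of length at most `3n+1`. The number of undefined words is subadditive under products,
so the length inside `G31`, or inside any finitely generated subgroup that contains `farFlip n`, is
at least a constant times `2^n` (`exists_two_pow_le`).

Upper bound. Inserting a multiple of three bits into the middle of a word does not disturb the
blocks of three on either side. Hence every element of `⟨G31, κ_321⟩` treats a word and its padded
version alike, up to a margin at the two ends that adds up under products (`Local.mul`,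
`exists_local`). If a product of `n` generators lies in `G31`, it is defined at sufficiently padded
words, and therefore already at words of length linear in `n` (`Local.definedFrom`,
`exists_linear_depth`). An element of depth `D` has trees with at most `3^D` inner vertices and is a
product of at most `25 * 9^D` exchanges of short prefixes (`Coloring.wordOn_of_definedFrom`).
Together these give an exponential bound.

The last estimate, and finite generation, are proved for all three subgroups at once. A `Coloring`
records which words may be exchanged: those of the same colour, where the colour is constant for
`G31`, and for the other two groups is the length modulo 3 on binary words with one further value
for all words containing `#`. -/

namespace BigThompson

/-! ### Incomparable words -/

section Words

variable {A : Type*}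

/-- Two words neither of which is a prefix of the other. -/
def Inc (u v : List A) : Prop := ¬ u <+: v ∧ ¬ v <+: u

theorem Inc.symm {u v : List A} (h : Inc u v) : Inc v u := ⟨h.2, h.1⟩

theorem Inc.ne_nil {u v : List A} (h : Inc u v) : u ≠ [] := by
  rintro rfl
  exact h.1 (List.nil_prefix)

theorem Inc.append_right {u v : List A} (h : Inc u v) (z : List A) : Inc u (v ++ z) := by
  refine ⟨fun h1 => ?_, fun h1 => h.2 ((List.prefix_append v z).trans h1)⟩
  rcases List.prefix_or_prefix_of_prefix h1 (List.prefix_append v z) with h2 | h2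
  · exact h.1 h2
  · exact h.2 h2

theorem Inc.of_length_eq {u v : List A} (h : u.length = v.length) (hne : u ≠ v) : Inc u v :=
  ⟨fun h1 => hne (h1.eq_of_length h), fun h1 => hne (h1.eq_of_length h.symm).symm⟩

theorem prefix_or_inc {u x : List A} (h : u.length ≤ x.length) : u <+: x ∨ Inc u x := by
  by_cases h1 : u <+: x
  · exact Or.inl h1
  · refine Or.inr ⟨h1, fun h2 => h1 ?_⟩
    rw [h2.eq_of_length (le_antisymm h2.length_le h)]

theorem Inc.ne_append {u v : List A} (h : Inc u v) (z z' : List A) : u ++ z ≠ v ++ z' := by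
  intro e
  rcases List.prefix_or_prefix_of_prefix (List.prefix_append u z)
    (e ▸ List.prefix_append v z') with h2 | h2
  · exact h.1 h2
  · exact h.2 h2

end Words

/-! ### Maximality as a density criterion -/

namespace BigG

variable {A : Type*}

/-- A maximal isomorphism equals its own maximum extension, and compatibility with that extension
can be tested after any further continuation `z`, since common suffixes cancel. -/
theorem mem_of_dense {f : BigG A} {x y : List A}
    (h : ∀ v, ∃ z, y ++ v ++ z ∈ f.map (x ++ v ++ z)) : y ∈ f.map x := by
  have hm : f.toEssIso.maxMap = f.map :=
    f.maximal _ f.toEssIso.maxMap_iso f.toEssIso.map_le_maxMap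
  rw [← hm, EssIso.mem_maxMap]
  intro v
  obtain ⟨z, hz⟩ := h v
  constructor
  · intro w hw
    exact List.append_cancel_right (Option.mem_unique (f.iso _ _ z hw) hz)
  · intro w hw
    exact List.append_cancel_right (f.map.inj (f.iso _ _ z hw) hz)

theorem ext_dense {f g : BigG A}
    (h : ∀ x, ∃ z y, y ∈ f.map (x ++ z) ∧ y ∈ g.map (x ++ z)) : f = g := by
  refine BigG.ext (f.maximal _ g.iso fun x y hy => mem_of_dense fun v => ?_).symm
  obtain ⟨z, w, hf, hg⟩ := h (x ++ v)
  refine ⟨z, ?_⟩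
  have h1 := f.iso _ _ (v ++ z) hy
  rw [← List.append_assoc, ← List.append_assoc] at h1
  rwa [Option.mem_unique h1 hf]

theorem exists_extension (f : BigG A) (x : List A) : ∃ z y, y ∈ f.map (x ++ z) :=
  f.toEssIso.exists_domain x

end BigG

/-! ### Exchanges of two prefixes -/

section Swap

variable {A : Type*}

/-- The graph of the exchange of the prefixes `u` and `v`. -/
def SwapRel (u v x y : List A) : Prop :=
  (∃ z, x = u ++ z ∧ y = v ++ z) ∨ (∃ z, x = v ++ z ∧ y = u ++ z) ∨ (y = x ∧ Inc u x ∧ Inc v x)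

theorem SwapRel.symm {u v x y : List A} (h : SwapRel u v x y) : SwapRel u v y x := by
  rcases h with ⟨z, h1, h2⟩ | ⟨z, h1, h2⟩ | ⟨rfl, h⟩
  · exact Or.inr (Or.inl ⟨z, h2, h1⟩)
  · exact Or.inl ⟨z, h2, h1⟩
  · exact Or.inr (Or.inr ⟨rfl, h⟩)

theorem SwapRel.unique {u v : List A} (h : Inc u v) (x y y' : List A)
    (h1 : SwapRel u v x y) (h2 : SwapRel u v x y') : y = y' := by
  rcases h1 with ⟨z, rfl, rfl⟩ | ⟨z, rfl, rfl⟩ | ⟨rfl, h3, h4⟩ <;>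
  rcases h2 with ⟨z', h5, rfl⟩ | ⟨z', h5, rfl⟩ | ⟨rfl, h5, h6⟩
  · rw [List.append_cancel_left h5]
  · exact (h.ne_append _ _ h5).elim
  · exact (h5.1 (List.prefix_append _ _)).elim
  · exact (h.ne_append _ _ h5.symm).elim
  · rw [List.append_cancel_left h5]
  · exact (h6.1 (List.prefix_append _ _)).elim
  · exact (h3.1 (h5 ▸ List.prefix_append _ _)).elim
  · exact (h4.1 (h5 ▸ List.prefix_append _ _)).elim
  · rfl

theorem SwapRel.cover (u v x : List A) (h1 : u.length ≤ x.length)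
    (h2 : v.length ≤ x.length) : ∃ y, SwapRel u v x y := by
  rcases prefix_or_inc h1 with ⟨z, rfl⟩ | h3
  · exact ⟨_, Or.inl ⟨z, rfl, rfl⟩⟩
  rcases prefix_or_inc h2 with ⟨z, rfl⟩ | h4
  · exact ⟨_, Or.inr (Or.inl ⟨z, rfl, rfl⟩)⟩
  · exact ⟨x, Or.inr (Or.inr ⟨rfl, h3, h4⟩)⟩

theorem Inc.map {f : BigG A} {u v u' v' : List A} (h : Inc u v) (hu : u' ∈ f.map u)
    (hv : v' ∈ f.map v) : Inc u' v' := by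
  constructor
  · rintro ⟨z, rfl⟩
    exact h.1 ⟨z, f.map.inj (f.iso _ _ z hu) hv⟩
  · rintro ⟨z, rfl⟩
    exact h.2 ⟨z, f.map.inj (f.iso _ _ z hv) hu⟩

variable [Nonempty A]

/-- The exchange of the incomparable prefixes `u` and `v`. -/
noncomputable def swapIso (u v : List A) (h : Inc u v) : EssIso A where
  map := pequivOfRel (SwapRel u v) (SwapRel.unique h)
    (fun x x' y h1 h2 => SwapRel.unique h y x x' h1.symm h2.symm)
  iso := by
    intro x y z h
    rw [mem_pequivOfRel] at *
    rcases h with ⟨t, rfl, rfl⟩ | ⟨t, rfl, rfl⟩ | ⟨rfl, h1, h2⟩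
    · exact Or.inl ⟨t ++ z, by simp, by simp⟩
    · exact Or.inr (Or.inl ⟨t ++ z, by simp, by simp⟩)
    · exact Or.inr (Or.inr ⟨rfl, h1.append_right z, h2.append_right z⟩)
  ess_domain := by
    rintro J hJ ⟨x, hx⟩
    obtain ⟨y, hy⟩ := SwapRel.cover u v (x ++ List.replicate (u.length + v.length)
      (Classical.arbitrary A)) (by simp; omega) (by simp; omega)
    exact ⟨_, ⟨y, mem_pequivOfRel.2 hy⟩, hJ x hx _⟩
  ess_image := by
    rintro J hJ ⟨x, hx⟩
    obtain ⟨y, hy⟩ := SwapRel.cover u v (x ++ List.replicate (u.length + v.length)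
      (Classical.arbitrary A)) (by simp; omega) (by simp; omega)
    exact ⟨_, ⟨y, mem_pequivOfRel.2 hy.symm⟩, hJ x hx _⟩

open Classical in
/-- The element that exchanges the prefixes `u` and `v` (trivial if they are comparable). -/
noncomputable def swap (u v : List A) : BigG A :=
  if h : Inc u v then (swapIso u v h).maxExt else 1

theorem mem_swap {u v x y : List A} (h : Inc u v) (hr : SwapRel u v x y) :
    y ∈ (swap u v).map x := by
  rw [swap, dif_pos h]
  exact EssIso.map_le_maxMap (swapIso u v h) _ _ (mem_pequivOfRel (hf := SwapRel.unique h)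
    (hi := fun x x' y h1 h2 => SwapRel.unique h y x x' h1.symm h2.symm).2 hr)

theorem swap_left {u v : List A} (h : Inc u v) (z : List A) : v ++ z ∈ (swap u v).map (u ++ z) :=
  mem_swap h (Or.inl ⟨z, rfl, rfl⟩)

theorem swap_right {u v : List A} (h : Inc u v) (z : List A) : u ++ z ∈ (swap u v).map (v ++ z) :=
  mem_swap h (Or.inr (Or.inl ⟨z, rfl, rfl⟩))

theorem swap_fix {u v x : List A} (h : Inc u v) (h1 : Inc u x) (h2 : Inc v x) :
    x ∈ (swap u v).map x :=
  mem_swap h (Or.inr (Or.inr ⟨rfl, h1, h2⟩))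

/-- By density it suffices to know `f` on long words. The condition off `u` and `v` asks only for
some continuation, which is what a conjugate by a partially defined map can provide. -/
theorem eq_swap {u v : List A} (h : Inc u v) {f : BigG A} (h1 : v ∈ f.map u) (h2 : u ∈ f.map v)
    (h3 : ∀ x, Inc u x → Inc v x → ∃ z, x ++ z ∈ f.map (x ++ z)) : f = swap u v := by
  refine BigG.ext_dense fun x => ?_
  obtain ⟨a, ha⟩ : ∃ a : List A, a.length = u.length + v.length :=
    ⟨List.replicate (u.length + v.length) (Classical.arbitrary A), by simp⟩
  obtain ⟨y, hy⟩ := SwapRel.cover u v (x ++ a) (by simp; omega) (by simp; omega)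
  rcases hy with ⟨z, hz, rfl⟩ | ⟨z, hz, rfl⟩ | ⟨rfl, h4, h5⟩
  · exact ⟨a, v ++ z, hz ▸ f.iso _ _ z h1, hz ▸ swap_left h z⟩
  · exact ⟨a, u ++ z, hz ▸ f.iso _ _ z h2, hz ▸ swap_right h z⟩
  · obtain ⟨z, hz⟩ := h3 _ h4 h5
    refine ⟨a ++ z, _, by rw [← List.append_assoc]; exact hz, ?_⟩
    rw [← List.append_assoc]
    exact swap_fix h (h4.append_right z) (h5.append_right z)

theorem swap_comm {u v : List A} (h : Inc u v) : swap u v = swap v u :=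
  eq_swap h.symm (by simpa using swap_right h []) (by simpa using swap_left h [])
    fun x h1 h2 => ⟨[], by simpa using swap_fix h h2 h1⟩

theorem swap_inv {u v : List A} (h : Inc u v) : (swap u v)⁻¹ = swap u v :=
  eq_swap h (BigG.mem_inv.2 (by simpa using swap_right h []))
    (BigG.mem_inv.2 (by simpa using swap_left h []))
    fun x h1 h2 => ⟨[], BigG.mem_inv.2 (by simpa using swap_fix h h1 h2)⟩

theorem conj_swap {g : BigG A} {u v u' v' : List A} (h : Inc u v) (hu : u' ∈ g.map u)
    (hv : v' ∈ g.map v) : g * swap u v * g⁻¹ = swap u' v' := by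
  refine eq_swap (h.map hu hv) ?_ ?_ ?_
  · exact BigG.mem_mul (BigG.mem_inv.2 hu) (BigG.mem_mul (by simpa using swap_left h []) hv)
  · exact BigG.mem_mul (BigG.mem_inv.2 hv) (BigG.mem_mul (by simpa using swap_right h []) hu)
  · intro x h1 h2
    obtain ⟨z, t, ht⟩ := g⁻¹.exists_extension x
    have ht' := BigG.mem_inv.1 ht
    refine ⟨z, BigG.mem_mul ht (BigG.mem_mul (swap_fix h ?_ ?_) ht')⟩
    · exact (h1.append_right z).map (BigG.mem_inv.2 hu) ht
    · exact (h2.append_right z).map (BigG.mem_inv.2 hv) ht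

end Swap

/-! ### Word length and additive costs -/

section WordOn

theorem exists_uniform_bound {G : Type*} {S : Set G} (hS : S.Finite) {P : ℕ → G → Prop}
    (hmono : ∀ a b x, P a x → a ≤ b → P b x) (h : ∀ s ∈ S, ∃ c, P c s) :
    ∃ c, ∀ s ∈ S, P c s := by
  induction S, hS using Set.Finite.induction_on with
  | empty => exact ⟨0, by simp⟩
  | @insert a S _ _ ih =>
    obtain ⟨c, hc⟩ := ih fun s hs => h s (Set.mem_insert_of_mem _ hs)
    obtain ⟨d, hd⟩ := h a (Set.mem_insert _ _)
    refine ⟨c + d, fun s hs => ?_⟩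
    rcases Set.mem_insert_iff.1 hs with rfl | hs
    · exact hmono _ _ _ hd (by omega)
    · exact hmono _ _ _ (hc s hs) (by omega)

variable {G : Type*} [Group G]

/-- `g` is a product of at most `n` elements of `S ∪ S⁻¹`. -/
def WordOn (S : Set G) (n : ℕ) (g : G) : Prop :=
  ∃ l : List G, l.length ≤ n ∧ (∀ s ∈ l, s ∈ S ∨ s⁻¹ ∈ S) ∧ l.prod = g

theorem WordOn.one (S : Set G) : WordOn S 0 (1 : G) := ⟨[], by simp⟩

theorem WordOn.of_mem {S : Set G} {g : G} (h : g ∈ S) : WordOn S 1 g :=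
  ⟨[g], by simp, by simp [h], by simp⟩

theorem WordOn.mono {S : Set G} {m n : ℕ} {g : G} (h : WordOn S m g) (hmn : m ≤ n) :
    WordOn S n g := by
  obtain ⟨l, h1, h2⟩ := h
  exact ⟨l, h1.trans hmn, h2⟩

theorem WordOn.mul {S : Set G} {m n : ℕ} {g h : G} (hg : WordOn S m g) (hh : WordOn S n h) :
    WordOn S (m + n) (g * h) := by
  obtain ⟨l, h1, h2, rfl⟩ := hg
  obtain ⟨l', h3, h4, rfl⟩ := hh
  refine ⟨l ++ l', by simp; omega, ?_, by simp⟩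
  intro s hs
  rcases List.mem_append.1 hs with hs | hs
  · exact h2 s hs
  · exact h4 s hs

theorem WordOn.inv {S : Set G} {n : ℕ} {g : G} (hg : WordOn S n g) : WordOn S n g⁻¹ := by
  obtain ⟨l, h1, h2, rfl⟩ := hg
  refine ⟨(l.map (·⁻¹)).reverse, by simpa using h1, ?_, by rw [List.prod_inv_reverse]⟩
  intro s hs
  simp only [List.mem_reverse, List.mem_map] at hs
  obtain ⟨t, ht, rfl⟩ := hs
  rw [inv_inv]
  exact (h2 t ht).symm

theorem WordOn.pow {S : Set G} {n : ℕ} {g : G} (hg : WordOn S n g) (k : ℕ) :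
    WordOn S (k * n) (g ^ k) := by
  induction k with
  | zero => simpa using WordOn.one S
  | succ k ih => rw [pow_succ, add_mul, one_mul]; exact ih.mul hg

theorem WordOn.mem_closure {S : Set G} {n : ℕ} {g : G} (hg : WordOn S n g) :
    g ∈ Subgroup.closure S := by
  obtain ⟨l, -, h2, rfl⟩ := hg
  refine Subgroup.list_prod_mem _ fun s hs => ?_
  rcases h2 s hs with h | h
  · exact Subgroup.subset_closure h
  · exact (Subgroup.inv_mem_iff _).1 (Subgroup.subset_closure h)

theorem exists_wordOn {S : Set G} {g : G} (hg : g ∈ Subgroup.closure S) : ∃ n, WordOn S n g := by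
  induction hg using Subgroup.closure_induction with
  | mem x hx => exact ⟨1, WordOn.of_mem hx⟩
  | one => exact ⟨0, .one S⟩
  | mul x y _ _ hx hy =>
    obtain ⟨m, hm⟩ := hx
    obtain ⟨n, hn⟩ := hy
    exact ⟨_, hm.mul hn⟩
  | inv x _ hx =>
    obtain ⟨m, hm⟩ := hx
    exact ⟨m, hm.inv⟩

theorem WordOn.wordLength_le {S : Set G} {n : ℕ} {g : G} (hg : WordOn S n g) :
    wordLength S g ≤ n := by
  obtain ⟨l, h1, h2⟩ := hg
  unfold wordLength
  refine le_trans (Nat.sInf_le (m := l.length) ?_) h1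
  exact ⟨l, rfl, h2⟩

theorem wordOn_wordLength {S : Set G} {g : G} (hg : g ∈ Subgroup.closure S) :
    WordOn S (wordLength S g) g := by
  obtain ⟨n, l, h1, h2⟩ := exists_wordOn hg
  obtain ⟨l', h3, h4⟩ := Nat.sInf_mem (⟨l.length, l, rfl, h2⟩ :
    {n | ∃ l : List G, l.length = n ∧ (∀ s ∈ l, s ∈ S ∨ s⁻¹ ∈ S) ∧ l.prod = g}.Nonempty)
  exact ⟨l', h3.le, h4⟩

/-- A property of group elements with an additive cost, bounded by `c` on the letters, costs at
most `c * n` on words of length `n`. -/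
theorem WordOn.induction {P : ℕ → G → Prop} (h1 : P 0 1)
    (hm : ∀ a b x y, P a x → P b y → P (a + b) (x * y)) {S : Set G} {c : ℕ}
    (hS : ∀ s ∈ S, P c s ∧ P c s⁻¹) (hmono : ∀ a b x, P a x → a ≤ b → P b x)
    {n : ℕ} {g : G} (hg : WordOn S n g) : P (c * n) g := by
  obtain ⟨l, hl, h2, rfl⟩ := hg
  refine hmono (c * l.length) _ _ ?_ (Nat.mul_le_mul_left c hl)
  clear hl
  induction l with
  | nil => simpa using h1
  | cons a t ih =>
    rw [List.prod_cons, List.length_cons, Nat.mul_succ, add_comm]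
    refine hm _ _ _ _ ?_ (ih fun s hs => h2 s (List.mem_cons_of_mem _ hs))
    rcases h2 a List.mem_cons_self with h | h
    · exact (hS a h).1
    · simpa using (hS _ h).2

/-- Word lengths over a finite set are bounded by a multiple of those over any set that generates
its elements. -/
theorem exists_wordOn_of_finite {S T : Set G} (hS : S.Finite)
    (h : S ⊆ Subgroup.closure T) : ∃ c, ∀ n g, WordOn S n g → WordOn T (c * n) g := by
  obtain ⟨c, hc⟩ := exists_uniform_bound hS (P := fun c s => WordOn T c s)
    (fun a b x hx hab => hx.mono hab) fun s hs => exists_wordOn (h hs)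
  exact ⟨c, fun n g hg => WordOn.induction (P := fun c g => WordOn T c g) (.one T)
    (fun a b x y hx hy => hx.mul hy) (fun s hs => ⟨hc s hs, (hc s hs).inv⟩)
    (fun a b x hx hab => hx.mono hab) hg⟩

end WordOn

/-! ### Prefix-closed trees and tables of elements -/

section Tables

open Finset

/-- A set of words that contains all prefixes of its elements. -/
def PrefixClosed (I : Finset (List Letter)) : Prop := ∀ x z, x ++ z ∈ I → x ∈ I

/-- The leaves of the tree whose inner vertices form the prefix-closed set `I`. -/
def leaves (I : Finset (List Letter)) : Finset (List Letter) :=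
  insert [] ((I ×ˢ (univ : Finset Letter)).image fun p => p.1 ++ [p.2]) \ I

theorem mem_leaves {I : Finset (List Letter)} {x : List Letter} :
    x ∈ leaves I ↔ (x = [] ∨ ∃ y ∈ I, ∃ a, x = y ++ [a]) ∧ x ∉ I := by
  simp only [leaves, mem_sdiff, mem_insert, mem_image, mem_product, mem_univ, and_true,
    Prod.exists]
  refine and_congr_left fun _ => or_congr_right ⟨?_, ?_⟩
  · rintro ⟨y, a, h, rfl⟩
    exact ⟨y, h, a, rfl⟩
  · rintro ⟨y, h, a, rfl⟩
    exact ⟨y, a, h, rfl⟩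

theorem exists_leaf_prefix {I : Finset (List Letter)} {x : List Letter} (hx : x ∉ I) :
    ∃ l ∈ leaves I, l <+: x := by
  induction x using List.reverseRecOn with
  | nil => exact ⟨[], mem_leaves.2 ⟨Or.inl rfl, hx⟩, List.prefix_rfl⟩
  | append_singleton x a ih =>
    by_cases h : x ∈ I
    · exact ⟨_, mem_leaves.2 ⟨Or.inr ⟨x, h, a, rfl⟩, hx⟩, List.prefix_rfl⟩
    · obtain ⟨l, hl, hp⟩ := ih h
      exact ⟨l, hl, hp.trans (List.prefix_append _ _)⟩

theorem eq_of_prefix_leaf {I : Finset (List Letter)} (hI : PrefixClosed I) {x l : List Letter}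
    (hl : l ∈ leaves I) (hx : x ∉ I) (h : x <+: l) : x = l := by
  obtain ⟨h1, h2⟩ := mem_leaves.1 hl
  rcases h1 with rfl | ⟨y, hy, a, rfl⟩
  · exact List.prefix_nil.1 h
  · rcases List.prefix_concat_iff.1 h with h | ⟨t, rfl⟩
    · exact h
    · exact (hx (hI _ _ hy)).elim

theorem inc_of_leaves {I : Finset (List Letter)} (hI : PrefixClosed I) {l l' : List Letter}
    (hl : l ∈ leaves I) (hl' : l' ∈ leaves I) (h : l ≠ l') : Inc l l' :=
  ⟨fun h1 => h (eq_of_prefix_leaf hI hl' (mem_leaves.1 hl).2 h1),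
    fun h1 => h (eq_of_prefix_leaf hI hl (mem_leaves.1 hl').2 h1).symm⟩

/-- The `x.length + 1` prefixes of `x` are distinct elements of `I`. -/
theorem PrefixClosed.length_lt {I : Finset (List Letter)} (hI : PrefixClosed I)
    {x : List Letter} (hx : x ∈ I) : x.length < #I := by
  have h : #((range (x.length + 1)).image fun k => x.take k) ≤ #I := by
    refine card_le_card fun y hy => ?_
    obtain ⟨k, -, rfl⟩ := mem_image.1 hy
    exact hI _ (x.drop k) (by rwa [List.take_append_drop])
  rw [card_image_of_injOn, card_range] at h
  · exact h
  · intro a ha b hb hab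
    have := congrArg List.length hab
    simp only [coe_range, Set.mem_Iio] at ha hb
    simp only [List.length_take] at this
    omega

theorem PrefixClosed.leaf_length_le {I : Finset (List Letter)} (hI : PrefixClosed I)
    {x : List Letter} (hx : x ∈ leaves I) : x.length ≤ #I := by
  rcases (mem_leaves.1 hx).1 with rfl | ⟨y, hy, a, rfl⟩
  · simp
  · simpa using hI.length_lt hy

theorem card_leaves_le (I : Finset (List Letter)) : #(leaves I) ≤ 3 * #I + 1 := by
  refine (card_le_card sdiff_subset).trans ((card_insert_le _ _).trans ?_)
  refine Nat.succ_le_succ (card_image_le.trans ?_)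
  rw [card_product, mul_comm]
  simp

/-- Double counting: each vertex of the tree, inner or leaf, is either the root or a child of
exactly one inner vertex. -/
theorem card_filter_leaves {I : Finset (List Letter)} (hI : PrefixClosed I)
    (τ : List Letter → ℕ) (t : ℕ) :
    #{x ∈ leaves I | τ x = t} + #{x ∈ I | τ x = t} =
      (if τ [] = t then 1 else 0) + ∑ x ∈ I, #{a : Letter | τ (x ++ [a]) = t} := by
  set C := (I ×ˢ (univ : Finset Letter)).image fun p => p.1 ++ [p.2] with hC
  have hsub : I ⊆ insert [] C := by
    intro x hx
    rcases List.eq_nil_or_concat x with rfl | ⟨y, a, rfl⟩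
    · exact mem_insert_self _ _
    · rw [List.concat_eq_append] at *
      exact mem_insert_of_mem (mem_image.2 ⟨(y, a), by simp [hI _ _ hx], rfl⟩)
  have h1 : #{x ∈ leaves I | τ x = t} + #{x ∈ I | τ x = t} = #{x ∈ insert [] C | τ x = t} := by
    rw [← card_union_of_disjoint, ← filter_union, leaves, sdiff_union_of_subset hsub]
    exact disjoint_filter_filter sdiff_disjoint
  have h2 : ([] : List Letter) ∉ C := by simp [hC]
  have h3 : #{x ∈ C | τ x = t} = ∑ x ∈ I, #{a : Letter | τ (x ++ [a]) = t} := by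
    rw [hC, filter_image, card_image_of_injective, card_filter, sum_product]
    · simp only [card_filter]
    · rintro ⟨x, a⟩ ⟨y, b⟩ h
      have := List.append_inj' h rfl
      simpa using this
  rw [h1, filter_insert]
  split_ifs with h
  · rw [card_insert_of_notMem (by simp [h2]), h3, add_comm]
  · rw [h3, zero_add]

/-- `f` restricts to a bijection between the complements of the prefix-closed sets `I`, `J`. -/
structure Table (f : BigG31) (I J : Finset (List Letter)) : Prop where
  closed_left : PrefixClosed I
  closed_right : PrefixClosed J
  fwd : ∀ x ∉ I, ∃ y ∉ J, y ∈ f.map x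
  bwd : ∀ y ∉ J, ∃ x ∉ I, y ∈ f.map x

theorem Table.inv {f : BigG31} {I J : Finset (List Letter)} (h : Table f I J) :
    Table f⁻¹ J I where
  closed_left := h.closed_right
  closed_right := h.closed_left
  fwd y hy := by
    obtain ⟨x, hx, hxy⟩ := h.bwd y hy
    exact ⟨x, hx, BigG.mem_inv.2 hxy⟩
  bwd x hx := by
    obtain ⟨y, hy, hxy⟩ := h.fwd x hx
    exact ⟨y, hy, BigG.mem_inv.2 hxy⟩

/-- Leaves are the minimal words of the complements. A leaf of `J` above the image of `l` pulls back
to a prefix of `l` outside `I`, which must be `l` itself. -/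
theorem Table.leaf {f : BigG31} {I J : Finset (List Letter)} (h : Table f I J)
    {l : List Letter} (hl : l ∈ leaves I) : ∃ y ∈ leaves J, y ∈ f.map l := by
  obtain ⟨y, hy, hly⟩ := h.fwd l (mem_leaves.1 hl).2
  obtain ⟨y', hy', z, rfl⟩ := exists_leaf_prefix hy
  obtain ⟨x, hx, hxy⟩ := h.bwd y' (mem_leaves.1 hy').2
  have e : x ++ z = l := f.map.inj (f.iso _ _ z hxy) hly
  have e' := eq_of_prefix_leaf h.closed_left hl hx ⟨z, e⟩
  subst e'
  exact ⟨y', hy', hxy⟩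

end Tables

/-! ### Coloured subgroups: generation by short exchanges -/

/-- `f` is defined on all words of length at least `D`. -/
def DefinedFrom (D : ℕ) (f : BigG31) : Prop := ∀ x : List Letter, D ≤ x.length → x ∈ domain f.map

theorem exists_definedFrom {f : BigG31} (hf : f ∈ G31) :
    ∃ D, DefinedFrom D f ∧ DefinedFrom D f⁻¹ := by
  obtain ⟨M, hM⟩ := (isFinGen_iff f.iso.domain_ideal f.ess_domain).1 hf.1
  obtain ⟨N, hN⟩ := (isFinGen_iff f⁻¹.iso.domain_ideal f⁻¹.ess_domain).1 (inv_mem hf).1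
  exact ⟨M + N, fun x hx => hM x (by omega), fun x hx => hN x (by omega)⟩

/-- Data that describe a subgroup of the Thompson-Higman group by colours of words: `Inn` contains
the words at which an element may be undefined, `Adm` the words that may be exchanged. -/
structure Coloring (H : Subgroup BigG31) (Inn Adm : Set (List Letter)) (τ : List Letter → ℕ) :
    Prop where
  le_G31 : H ≤ G31
  nil_adm : [] ∈ Adm
  inn_adm : Inn ⊆ Adm
  child_adm : ∀ x ∈ Inn, ∀ a, x ++ [a] ∈ Adm
  undefined : ∀ f ∈ H, ∀ x, x ∉ domain f.map → x ∈ Inn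
  color : ∀ f ∈ H, ∀ x ∈ Adm, ∀ y ∈ f.map x, τ y = τ x
  swap_mem : ∀ u ∈ Adm, ∀ v ∈ Adm, τ u = τ v → Inc u v → swap u v ∈ H
  congr_inn : ∀ u ∈ Inn, ∀ v ∈ Inn, τ u = τ v → ∀ w, u ++ w ∈ Inn → v ++ w ∈ Inn
  congr_adm : ∀ u ∈ Adm, ∀ v ∈ Adm, τ u = τ v → ∀ w, u ++ w ∈ Adm →
    v ++ w ∈ Adm ∧ τ (v ++ w) = τ (u ++ w)
  -- Elements of the group match leaves of equal colour; this field transfers the equality to inner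
  -- vertices, where the subtrees to be moved are found.
  count : ∀ I J : Finset (List Letter), PrefixClosed I → PrefixClosed J →
    (∀ x ∈ I, x ∈ Inn) → (∀ x ∈ J, x ∈ Inn) →
    (∀ t, ((leaves I).filter (τ · = t)).card = ((leaves J).filter (τ · = t)).card) →
    ∀ t, (I.filter (τ · = t)).card = (J.filter (τ · = t)).card
  -- Conjugation by the exchange of `a` and `b` shortens `u`; incomparability of `b` and `v`
  -- prevents `v` from growing in return.
  shorten : ∀ u ∈ Adm, 7 ≤ u.length → ∀ v ≠ [], ∃ a ∈ Adm, ∃ b ∈ Adm, a <+: u ∧ τ a = τ b ∧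
    a.length ≤ 7 ∧ b.length < a.length ∧ Inc a b ∧ Inc b v

/-- The exchanges of admissible words of the same colour and of length at most `L`. -/
def swapSet (Adm : Set (List Letter)) (τ : List Letter → ℕ) (L : ℕ) : Set BigG31 :=
  {g | ∃ u ∈ Adm, ∃ v ∈ Adm, τ u = τ v ∧ Inc u v ∧ u.length ≤ L ∧ v.length ≤ L ∧ g = swap u v}

theorem swap_mem_swapSet {Adm : Set (List Letter)} {τ : List Letter → ℕ} {L : ℕ}
    {u v : List Letter} (hu : u ∈ Adm) (hv : v ∈ Adm) (ht : τ u = τ v) (hi : Inc u v)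
    (hul : u.length ≤ L) (hvl : v.length ≤ L) : swap u v ∈ swapSet Adm τ L :=
  ⟨u, hu, v, hv, ht, hi, hul, hvl, rfl⟩

theorem swapSet_finite (Adm : Set (List Letter)) (τ : List Letter → ℕ) (L : ℕ) :
    (swapSet Adm τ L).Finite := by
  refine ((List.finite_length_le Letter L).image2 swap (List.finite_length_le Letter L)).subset ?_
  rintro g ⟨u, -, v, -, -, -, hu, hv, rfl⟩
  exact ⟨u, hu, v, hv, rfl⟩

namespace Coloring

variable {H : Subgroup BigG31} {Inn Adm : Set (List Letter)} {τ : List Letter → ℕ}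

theorem swapSet_subset (h : Coloring H Inn Adm τ) (L : ℕ) : swapSet Adm τ L ⊆ H := by
  rintro g ⟨u, hu, v, hv, ht, hi, -, -, rfl⟩
  exact h.swap_mem u hu v hv ht hi

/-- A long exchange is conjugate, by one short exchange, to an exchange of smaller total length.
Each conjugation costs two letters, which gives `2 * n + 1`. -/
theorem wordOn_swap (h : Coloring H Inn Adm τ) (n : ℕ) : ∀ u ∈ Adm, ∀ v ∈ Adm, τ u = τ v →
    Inc u v → u.length + v.length ≤ n → WordOn (swapSet Adm τ 7) (2 * n + 1) (swap u v) := by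
  induction n with
  | zero =>
    intro u _ v _ _ hi hn
    exact (hi.ne_nil (List.eq_nil_of_length_eq_zero (by omega))).elim
  | succ n ih =>
    have key : ∀ u ∈ Adm, ∀ v ∈ Adm, τ u = τ v → Inc u v → u.length + v.length ≤ n + 1 →
        7 ≤ u.length → WordOn (swapSet Adm τ 7) (2 * (n + 1) + 1) (swap u v) := by
      intro u hu v hv ht hi hn hl
      obtain ⟨a, ha, b, hb, ⟨w, rfl⟩, hab, hal, hbl, hi1, hi2⟩ :=
        h.shorten u hu hl v hi.symm.ne_nil
      set g : BigG31 := swap a b with hg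
      have hgw : WordOn (swapSet Adm τ 7) 1 g :=
        WordOn.of_mem (swap_mem_swapSet ha hb hab hi1 hal (by omega))
      have hu' : b ++ w ∈ g.map (a ++ w) := swap_left hi1 w
      obtain ⟨hu1, hu2⟩ := h.congr_adm a ha b hb hab w hu
      -- The exchange `g` replaces the prefix `a` of `v` by the shorter `b`, or else fixes `v`.
      obtain ⟨v', hv', hv1, hv2, hv3⟩ : ∃ v' ∈ g.map v, v' ∈ Adm ∧ τ v' = τ v ∧
          v'.length ≤ v.length := by
        by_cases hav : a <+: v
        · obtain ⟨z, rfl⟩ := hav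
          obtain ⟨h1, h2⟩ := h.congr_adm a ha b hb hab z hv
          exact ⟨_, swap_left hi1 z, h1, h2, by simp; omega⟩
        · refine ⟨v, swap_fix hi1 ⟨hav, fun h1 => ?_⟩ hi2, hv, rfl, le_rfl⟩
          exact hi.2 (h1.trans (List.prefix_append _ _))
      have e : swap (a ++ w) v = g⁻¹ * (swap (b ++ w) v' * g) := by
        rw [← conj_swap hi hu' hv']
        group
      rw [e]
      refine (hgw.inv.mul ((ih _ hu1 _ hv1 (by rw [hu2, hv2, ht]) (hi.map hu' hv') ?_).mul
        hgw)).mono (by omega)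
      simp only [List.length_append] at hn ⊢
      omega
    intro u hu v hv ht hi hn
    by_cases h1 : 7 ≤ u.length
    · exact key u hu v hv ht hi hn h1
    by_cases h2 : 7 ≤ v.length
    · rw [swap_comm hi]
      exact key v hv u hu ht.symm hi.symm (by omega) h2
    · exact (WordOn.of_mem (swap_mem_swapSet hu hv ht hi (by omega) (by omega))).mono (by omega)

theorem wordOn_of_wordOn_swapSet (h : Coloring H Inn Adm τ) {L n : ℕ} {g : BigG31}
    (hg : WordOn (swapSet Adm τ L) n g) : WordOn (swapSet Adm τ 7) ((4 * L + 1) * n) g := by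
  refine WordOn.induction (P := fun c g => WordOn (swapSet Adm τ 7) c g) (.one _)
    (fun a b x y hx hy => hx.mul hy) ?_ (fun a b x hx hab => hx.mono hab) hg
  rintro s ⟨u, hu, v, hv, ht, hi, h1, h2, rfl⟩
  have := (h.wordOn_swap (2 * L) u hu v hv ht hi (by omega)).mono (n := 4 * L + 1) (by omega)
  exact ⟨this, this.inv⟩

theorem leaf_adm (h : Coloring H Inn Adm τ) {I : Finset (List Letter)} (hI : ∀ x ∈ I, x ∈ Inn)
    {l : List Letter} (hl : l ∈ leaves I) : l ∈ Adm := by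
  rcases (mem_leaves.1 hl).1 with rfl | ⟨y, hy, a, rfl⟩
  · exact h.nil_adm
  · exact h.child_adm y (hI y hy) a

open Finset in
theorem card_leaves_le_of_table (h : Coloring H Inn Adm τ) {I J : Finset (List Letter)}
    {f : BigG31} (hf : f ∈ H) (hT : Table f I J) (hI : ∀ x ∈ I, x ∈ Inn) (t : ℕ) :
    #{x ∈ leaves I | τ x = t} ≤ #{x ∈ leaves J | τ x = t} := by
  have hl : ∀ l ∈ leaves I, ∃ y ∈ leaves J, y ∈ f.map l := fun l hl => hT.leaf hl
  choose! φ h1 h2 using hl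
  refine card_le_card_of_injOn φ ?_ ?_
  · intro l hl
    obtain ⟨hl1, hl2⟩ := mem_filter.1 hl
    refine mem_filter.2 ⟨h1 l hl1, ?_⟩
    rw [h.color f hf l (h.leaf_adm hI hl1) _ (h2 l hl1), hl2]
  · intro l hl l' hl' e
    have h3 := h2 l (mem_filter.1 hl).1
    rw [e] at h3
    exact f.map.inj h3 (h2 l' (mem_filter.1 hl').1)

-- The injections of leaves given by `f` and its inverse preserve colours, so the leaf counts agree,
-- and `count` passes this on to inner vertices.
open Finset in
theorem card_filter_eq (h : Coloring H Inn Adm τ) {I J : Finset (List Letter)}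
    {f : BigG31} (hf : f ∈ H) (hT : Table f I J) (hI : ∀ x ∈ I, x ∈ Inn)
    (hJ : ∀ x ∈ J, x ∈ Inn) (t : ℕ) : #{x ∈ I | τ x = t} = #{x ∈ J | τ x = t} :=
  h.count I J hT.closed_left hT.closed_right hI hJ (fun t => le_antisymm
    (h.card_leaves_le_of_table hf hT hI t)
    (h.card_leaves_le_of_table (inv_mem hf) hT.inv hJ t)) t

open Finset in
theorem card_eq (h : Coloring H Inn Adm τ) {I J : Finset (List Letter)}
    {f : BigG31} (hf : f ∈ H) (hT : Table f I J) (hI : ∀ x ∈ I, x ∈ Inn)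
    (hJ : ∀ x ∈ J, x ∈ Inn) : #I = #J := by
  rw [card_eq_sum_card_fiberwise (f := τ) (s := I) (t := (I ∪ J).image τ)
    fun x hx => mem_image_of_mem _ (mem_union_left _ hx),
    card_eq_sum_card_fiberwise (f := τ) (s := J) (t := (I ∪ J).image τ)
    fun x hx => mem_image_of_mem _ (mem_union_right _ hx)]
  exact sum_congr rfl fun t _ => h.card_filter_eq hf hT hI hJ t

open Finset in
/-- Moving a subtree of `I` by an exchange increases the common part of `I` and `J`. -/
theorem exists_swap_table (h : Coloring H Inn Adm τ) {I J : Finset (List Letter)}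
    {f : BigG31} (hf : f ∈ H) (hT : Table f I J) (hI : ∀ x ∈ I, x ∈ Inn)
    (hJ : ∀ x ∈ J, x ∈ Inn) (hne : (J \ I).Nonempty) :
    ∃ u ∈ Inn, ∃ v ∈ Inn, τ u = τ v ∧ Inc u v ∧ u.length ≤ #J ∧ v.length ≤ #J ∧
      ∃ I', Table (f * swap u v) I' J ∧ (∀ x ∈ I', x ∈ Inn) ∧ #(J \ I') < #(J \ I) := by
  -- By minimality all proper prefixes of `v` lie in `I`, so `v` is a leaf of `I` that `J` needs as
  -- an inner vertex.
  obtain ⟨v, hv, hmin⟩ := exists_min_image (J \ I) List.length hne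
  obtain ⟨hvJ, hvI⟩ := mem_sdiff.1 hv
  -- `I` and `J` have equally many inner vertices of the colour of `v`; since `v` is missing from
  -- `I`, some other one is missing from `J`.
  obtain ⟨u, huI, huJ, huv⟩ : ∃ u ∈ I, u ∉ J ∧ τ u = τ v := by
    by_contra! hcon
    have hsub : I.filter (τ · = τ v) ⊆ J.filter (τ · = τ v) := by
      intro x hx
      obtain ⟨hx1, hx2⟩ := mem_filter.1 hx
      exact mem_filter.2 ⟨by_contra fun hx3 => hcon x hx1 hx3 hx2, hx2⟩
    have := eq_of_subset_of_card_le hsub (h.card_filter_eq hf hT hI hJ _).ge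
    have hv' : v ∈ J.filter (τ · = τ v) := mem_filter.2 ⟨hvJ, rfl⟩
    rw [← this] at hv'
    exact hvI (mem_filter.1 hv').1
  have cI := hT.closed_left
  have cJ := hT.closed_right
  have hinc : Inc u v := by
    constructor
    · rintro ⟨z, rfl⟩
      exact huJ (cJ _ _ hvJ)
    · rintro ⟨z, rfl⟩
      exact hvI (cI _ _ huI)
  have hpre : ∀ x, x <+: v → x ≠ v → x ∈ I ∧ ¬ u <+: x := by
    rintro x ⟨z, rfl⟩ hx
    have hxJ := cJ _ _ hvJ
    constructor
    · by_contra hxI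
      have := hmin x (mem_sdiff.2 ⟨hxJ, hxI⟩)
      simp only [List.length_append] at this
      exact hx (by simp [List.eq_nil_of_length_eq_zero (by omega : z.length = 0)])
    · exact fun h1 => hinc.1 (h1.trans (List.prefix_append _ _))
  -- The subtree of `I` at `u` is cut off and grafted at `v`.
  set I' := I.filter (¬ u <+: ·) ∪ (I.filter (u <+: ·)).image fun x => v ++ x.drop u.length
    with hI'
  have hmem : ∀ x, x ∈ I' ↔ (x ∈ I ∧ ¬ u <+: x) ∨ ∃ w, u ++ w ∈ I ∧ x = v ++ w := by
    intro x
    simp only [hI', mem_union, mem_filter, mem_image]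
    refine or_congr_right ⟨?_, ?_⟩
    · rintro ⟨y, ⟨hy, w, rfl⟩, rfl⟩
      exact ⟨w, hy, by simp⟩
    · rintro ⟨w, hw, rfl⟩
      exact ⟨u ++ w, ⟨hw, List.prefix_append _ _⟩, by simp⟩
  have hvI' : v ∈ I' := (hmem v).2 (Or.inr ⟨[], by simpa using huI, by simp⟩)
  refine ⟨u, hI u huI, v, hJ v hvJ, huv, hinc, ?_, (cJ.length_lt hvJ).le, I', ?_, ?_, ?_⟩
  · rw [← h.card_eq hf hT hI hJ]
    exact (cI.length_lt huI).le
  · refine ⟨?_, cJ, ?_, ?_⟩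
    · intro x z hx
      rw [hmem] at hx ⊢
      rcases hx with ⟨h1, h2⟩ | ⟨w, hw, e⟩
      · exact Or.inl ⟨cI _ _ h1, fun h3 => h2 (h3.trans (List.prefix_append _ _))⟩
      · rcases List.prefix_or_prefix_of_prefix (List.prefix_append x z)
          (e ▸ List.prefix_append v w) with h1 | ⟨t, rfl⟩
        · by_cases h2 : x = v
          · exact Or.inr ⟨[], by simpa using huI, by simpa using h2⟩
          · exact Or.inl (hpre x h1 h2)
        · rw [List.append_assoc] at e
          have e' := List.append_cancel_left e
          refine Or.inr ⟨t, ?_, rfl⟩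
          rw [← e', ← List.append_assoc] at hw
          exact cI _ _ hw
    · intro x hx
      rw [hmem, not_or] at hx
      obtain ⟨hx1, hx2⟩ := hx
      obtain ⟨y, hy, hyI⟩ : ∃ y, SwapRel u v x y ∧ y ∉ I := by
        by_cases h1 : u <+: x
        · obtain ⟨z, rfl⟩ := h1
          exact ⟨_, Or.inl ⟨z, rfl, rfl⟩, fun h2 => hvI (cI _ _ h2)⟩
        have hxI : x ∉ I := fun h2 => hx1 ⟨h2, h1⟩
        by_cases h2 : v <+: x
        · obtain ⟨z, rfl⟩ := h2
          exact ⟨_, Or.inr (Or.inl ⟨z, rfl, rfl⟩), fun h2 => hx2 ⟨z, h2, rfl⟩⟩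
        refine ⟨x, Or.inr (Or.inr ⟨rfl, ⟨h1, ?_⟩, h2, ?_⟩), hxI⟩
        · rintro ⟨z, rfl⟩
          exact hxI (cI _ _ huI)
        · intro h3
          exact hxI (hpre x h3 fun e => h2 (e ▸ List.prefix_rfl)).1
      obtain ⟨z, hz, hyz⟩ := hT.fwd y hyI
      exact ⟨z, hz, BigG.mem_mul (mem_swap hinc hy) hyz⟩
    · intro z hz
      obtain ⟨y, hyI, hyz⟩ := hT.bwd z hz
      obtain ⟨x, hx, hxI⟩ : ∃ x, SwapRel u v x y ∧ x ∉ I' := by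
        simp only [hmem, not_or]
        by_cases h1 : u <+: y
        · obtain ⟨z, rfl⟩ := h1
          refine ⟨_, Or.inr (Or.inl ⟨z, rfl, rfl⟩), fun h2 => hvI (cI _ _ h2.1), ?_⟩
          rintro ⟨w, hw, e⟩
          rw [List.append_cancel_left e] at hyI
          exact hyI hw
        by_cases h2 : v <+: y
        · obtain ⟨z, rfl⟩ := h2
          refine ⟨_, Or.inl ⟨z, rfl, rfl⟩, fun h2 => h2.2 (List.prefix_append _ _), ?_⟩
          rintro ⟨w, hw, e⟩
          exact hinc.ne_append _ _ e
        refine ⟨y, Or.inr (Or.inr ⟨rfl, ⟨h1, ?_⟩, h2, ?_⟩), fun h3 => hyI h3.1, ?_⟩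
        · rintro ⟨z, rfl⟩
          exact hyI (cI _ _ huI)
        · intro h3
          exact hyI (hpre y h3 fun e => h2 (e ▸ List.prefix_rfl)).1
        · rintro ⟨w, hw, rfl⟩
          exact h2 (List.prefix_append _ _)
      exact ⟨x, hxI, BigG.mem_mul (mem_swap hinc hx) hyz⟩
  · intro x hx
    rcases (hmem x).1 hx with ⟨h1, -⟩ | ⟨w, hw, rfl⟩
    · exact hI x h1
    · exact h.congr_inn u (hI u huI) v (hJ v hvJ) huv w (hI _ hw)
  -- Nothing of `J` is lost, because `J` has no vertex below `u`, while `v` is gained.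
  · refine card_lt_card ⟨fun x hx => ?_, fun hsub => ?_⟩
    · obtain ⟨h1, h2⟩ := mem_sdiff.1 hx
      refine mem_sdiff.2 ⟨h1, fun h3 => h2 ((hmem x).2 (Or.inl ⟨h3, ?_⟩))⟩
      rintro ⟨z, rfl⟩
      exact huJ (cJ _ _ h1)
    · exact (mem_sdiff.1 (hsub hv)).2 hvI'

-- Each grafting step removes at least one vertex from `J \ I`. When none is left, `J ⊆ I`, and
-- equal cardinalities force `I = J`.
open Finset in
theorem exists_aligned (h : Coloring H Inn Adm τ) {J : Finset (List Letter)}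
    (hJ : ∀ x ∈ J, x ∈ Inn) (n : ℕ) : ∀ (I : Finset (List Letter)) (f : BigG31), f ∈ H →
    Table f I J → (∀ x ∈ I, x ∈ Inn) → #(J \ I) ≤ n →
    ∃ g, WordOn (swapSet Adm τ #J) n g ∧ Table (f * g) J J := by
  induction n with
  | zero =>
    intro I f hf hT hI hn
    have h1 : J ⊆ I := sdiff_eq_empty_iff_subset.1 (card_eq_zero.1 (by omega))
    have h2 : J = I := eq_of_subset_of_card_le h1 (h.card_eq hf hT hI hJ).le
    subst h2
    exact ⟨1, .one _, by simpa using hT⟩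
  | succ n ih =>
    intro I f hf hT hI hn
    by_cases hne : (J \ I).Nonempty
    · obtain ⟨u, hu, v, hv, ht, hi, hul, hvl, I', hT', hI', hlt⟩ :=
        h.exists_swap_table hf hT hI hJ hne
      have hu := h.inn_adm hu
      have hv := h.inn_adm hv
      obtain ⟨g, hg, hg'⟩ := ih I' _ (mul_mem hf (h.swap_mem u hu v hv ht hi)) hT' hI' (by omega)
      refine ⟨swap u v * g, ?_, by rwa [← mul_assoc]⟩
      rw [add_comm n]
      exact (WordOn.of_mem (swap_mem_swapSet hu hv ht hi hul hvl)).mul hg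
    · obtain ⟨g, hg, hg'⟩ := ih I f hf hT hI (by
        rw [not_nonempty_iff_eq_empty.1 hne, card_empty]; exact Nat.zero_le _)
      exact ⟨g, hg.mono (by omega), hg'⟩

-- With equal trees on both sides, `f` permutes the leaves. It is sorted by transpositions, each of
-- which fixes one more leaf.
open Finset Classical in
theorem wordOn_of_permutation (h : Coloring H Inn Adm τ) {J : Finset (List Letter)}
    (hJ : ∀ x ∈ J, x ∈ Inn) (n : ℕ) : ∀ f : BigG31, f ∈ H → Table f J J →
    #{l ∈ leaves J | l ∉ f.map l} ≤ n → WordOn (swapSet Adm τ #J) n f := by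
  induction n with
  | zero =>
    intro f hf hT hn
    have h1 : ∀ l ∈ leaves J, l ∈ f.map l := by
      intro l hl
      by_contra h2
      have := card_eq_zero.1 (Nat.le_zero.1 hn)
      exact (this ▸ notMem_empty l) (mem_filter.2 ⟨hl, h2⟩)
    have h2 : f = 1 := by
      refine BigG.ext_dense fun x => ?_
      have hx : x ++ List.replicate #J none ∉ J := by
        intro h3
        have := hT.closed_left.length_lt h3
        simp at this
      obtain ⟨l, hl, w, hw⟩ := exists_leaf_prefix hx
      refine ⟨List.replicate #J none, x ++ List.replicate #J none, ?_, BigG.mem_one.2 rfl⟩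
      rw [← hw]
      exact f.iso _ _ w (h1 l hl)
    rw [h2]
    exact .one _
  | succ n ih =>
    intro f hf hT hn
    by_cases hne : ∃ x ∈ leaves J, x ∉ f.map x
    · obtain ⟨x, hx, hfx⟩ := hne
      obtain ⟨y, hy, hxy⟩ := hT.leaf hx
      have hxne : x ≠ y := by
        rintro rfl
        exact hfx hxy
      have cJ := hT.closed_left
      have hi := inc_of_leaves cJ hx hy hxne
      have hxA := h.leaf_adm hJ hx
      have hyA := h.leaf_adm hJ hy
      have ht : τ x = τ y := (h.color f hf x hxA y hxy).symm
      have hσ : ∀ z ∉ J, ∃ w ∉ J, SwapRel x y z w := by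
        intro z hz
        obtain ⟨l, hl, t, rfl⟩ := exists_leaf_prefix hz
        by_cases h1 : l = x
        · exact ⟨y ++ t, fun h2 => (mem_leaves.1 hy).2 (cJ _ _ h2), Or.inl ⟨t, by rw [h1], rfl⟩⟩
        by_cases h2 : l = y
        · exact ⟨x ++ t, fun h2 => (mem_leaves.1 hx).2 (cJ _ _ h2),
            Or.inr (Or.inl ⟨t, by rw [h2], rfl⟩)⟩
        · exact ⟨l ++ t, hz, Or.inr (Or.inr ⟨rfl,
            (inc_of_leaves cJ hx hl (Ne.symm h1)).append_right t,
            (inc_of_leaves cJ hy hl (Ne.symm h2)).append_right t⟩)⟩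
      have hT' : Table (swap x y * f) J J := by
        refine ⟨cJ, cJ, fun z hz => ?_, fun z hz => ?_⟩
        · obtain ⟨w, hw, hzw⟩ := hT.fwd z hz
          obtain ⟨t, ht, hwt⟩ := hσ w hw
          exact ⟨t, ht, BigG.mem_mul hzw (mem_swap hi hwt)⟩
        · obtain ⟨w, hw, hzw⟩ := hσ z hz
          obtain ⟨t, ht, hwt⟩ := hT.bwd w hw
          exact ⟨t, ht, BigG.mem_mul hwt (mem_swap hi hzw.symm)⟩
      -- The leaf `x` becomes fixed. A leaf already fixed by `f` differs from `x`, and from `y` by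
      -- injectivity, so the exchange leaves it alone.
      have hlt : #{l ∈ leaves J | l ∉ (swap x y * f).map l} < #{l ∈ leaves J | l ∉ f.map l} := by
        refine card_lt_card ⟨fun l hl => ?_, fun hsub => ?_⟩
        · obtain ⟨h1, h2⟩ := mem_filter.1 hl
          refine mem_filter.2 ⟨h1, fun h3 => h2 ?_⟩
          have hlx : x ≠ l := by
            rintro rfl
            exact hfx h3
          have hly : y ≠ l := by
            rintro rfl
            exact hlx (f.map.inj hxy h3)
          exact BigG.mem_mul h3 (swap_fix hi (inc_of_leaves cJ hx h1 hlx)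
            (inc_of_leaves cJ hy h1 hly))
        · refine (mem_filter.1 (hsub (mem_filter.2 ⟨hx, hfx⟩))).2 (BigG.mem_mul hxy ?_)
          simpa using swap_right hi []
      have hw := ih _ (mul_mem (h.swap_mem x hxA y hyA ht hi) hf) hT' (by omega)
      have e : f = swap x y * (swap x y * f) := by
        nth_rewrite 1 [← swap_inv hi]
        simp
      rw [e, add_comm n]
      exact (WordOn.of_mem (swap_mem_swapSet hxA hyA ht hi (cJ.leaf_length_le hx)
        (cJ.leaf_length_le hy))).mul hw
    · push Not at hne
      refine (ih f hf hT ?_).mono (by omega)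
      rw [filter_eq_empty_iff.2 fun l hl => not_not.2 (hne l hl)]
      simp

open Finset in
theorem exists_finset_of_length_lt (D : ℕ) :
    ∃ W : Finset (List Letter), #W ≤ 3 ^ D ∧ ∀ x, x.length < D → x ∈ W := by
  -- The sharp count `(3^D - 1) / 2` of words shorter than `D` is what the induction carries.
  suffices h : ∃ W : Finset (List Letter), 2 * #W + 1 ≤ 3 ^ D ∧ ∀ x, x.length < D → x ∈ W by
    obtain ⟨W, h1, h2⟩ := h
    exact ⟨W, by omega, h2⟩
  induction D with
  | zero => exact ⟨∅, by simp, by simp⟩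
  | succ D ih =>
    obtain ⟨W, h1, h2⟩ := ih
    refine ⟨insert [] ((univ ×ˢ W).image fun p : Letter × List Letter => p.1 :: p.2), ?_, ?_⟩
    · have h3 := card_insert_le ([] : List Letter)
        ((univ ×ˢ W).image fun p : Letter × List Letter => p.1 :: p.2)
      have h4 : #((univ ×ˢ W).image fun p : Letter × List Letter => p.1 :: p.2) ≤ 3 * #W := by
        refine card_image_le.trans ?_
        rw [card_product]
        simp
      rw [pow_succ]
      omega
    · intro x hx
      cases x with
      | nil => exact mem_insert_self _ _
      | cons a t =>
        exact mem_insert_of_mem (mem_image.2 ⟨(a, t), by simp [h2 t (by simpa using hx)], rfl⟩)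

-- The trees are the sets of words at which `f` and its inverse are undefined; `f` is a bijection
-- between the complements.
open Finset in
theorem exists_table (h : Coloring H Inn Adm τ) {f : BigG31} (hf : f ∈ H) {D : ℕ}
    (h1 : DefinedFrom D f) (h2 : DefinedFrom D f⁻¹) :
    ∃ I J : Finset (List Letter), Table f I J ∧ (∀ x ∈ I, x ∈ Inn) ∧ (∀ x ∈ J, x ∈ Inn) ∧
      #J ≤ 3 ^ D := by
  classical
  obtain ⟨W, hW, hWD⟩ := exists_finset_of_length_lt D
  have key : ∀ g : BigG31, DefinedFrom D g → ∀ x, x ∉ W.filter (· ∉ domain g.map) ↔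
      x ∈ domain g.map := by
    intro g hg x
    simp only [mem_filter, not_and, not_not]
    refine ⟨fun h3 => ?_, fun h3 _ => h3⟩
    by_cases h4 : x.length < D
    · exact h3 (hWD x h4)
    · exact hg x (not_lt.1 h4)
  have closed : ∀ g : BigG31, DefinedFrom D g → PrefixClosed (W.filter (· ∉ domain g.map)) := by
    intro g hg x z hx
    by_contra h3
    rw [key g hg] at h3
    exact (key g hg _).2 (g.iso.domain_ideal x h3 z) hx
  refine ⟨W.filter (· ∉ domain f.map), W.filter (· ∉ domain f⁻¹.map),
    ⟨closed _ h1, closed _ h2, ?_, ?_⟩, ?_, ?_, (card_le_card (filter_subset _ _)).trans hW⟩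
  · intro x hx
    obtain ⟨y, hy⟩ := (key f h1 x).1 hx
    exact ⟨y, (key _ h2 y).2 ⟨x, BigG.mem_inv.2 hy⟩, hy⟩
  · intro y hy
    obtain ⟨x, hx⟩ := (key _ h2 y).1 hy
    exact ⟨x, (key _ h1 x).2 ⟨y, BigG.mem_inv.1 hx⟩, BigG.mem_inv.1 hx⟩
  · exact fun x hx => h.undefined f hf x (mem_filter.1 hx).2
  · exact fun x hx => h.undefined _ (inv_mem hf) x (mem_filter.1 hx).2

-- Aligning the trees takes at most `#J` exchanges, and sorting the leaves at most `3 * #J + 1`.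
-- Each exchange has depth at most `#J`, so it costs at most `4 * #J + 1` short ones; finally `#J ≤
-- 3 ^ D`.
open Finset in
theorem wordOn_of_definedFrom (h : Coloring H Inn Adm τ) {f : BigG31} (hf : f ∈ H) {D : ℕ}
    (h1 : DefinedFrom D f) (h2 : DefinedFrom D f⁻¹) :
    WordOn (swapSet Adm τ 7) (25 * 9 ^ D) f := by
  classical
  obtain ⟨I, J, hT, hI, hJ, hD⟩ := h.exists_table hf h1 h2
  obtain ⟨g, hg, hT'⟩ := h.exists_aligned hJ #J I f hf hT hI (card_le_card sdiff_subset)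
  have hgH : g ∈ H := (Subgroup.closure_le H).2 (h.swapSet_subset _) hg.mem_closure
  have hp := h.wordOn_of_permutation hJ (3 * #J + 1) _ (mul_mem hf hgH) hT'
    ((card_le_card (filter_subset _ _)).trans (card_leaves_le J))
  have hw := h.wordOn_of_wordOn_swapSet (hp.mul hg.inv)
  rw [mul_inv_cancel_right] at hw
  refine hw.mono ?_
  have e : (9 : ℕ) ^ D = 3 ^ D * 3 ^ D := by rw [← mul_pow]; norm_num
  have h3 : 1 ≤ 3 ^ D := Nat.one_le_pow _ _ (by norm_num)
  rw [e]
  calc (4 * #J + 1) * (3 * #J + 1 + #J) ≤ (5 * 3 ^ D) * (5 * 3 ^ D) := by gcongr <;> omega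
    _ = 25 * (3 ^ D * 3 ^ D) := by ring

theorem closure_swapSet (h : Coloring H Inn Adm τ) :
    Subgroup.closure (swapSet Adm τ 7) = H := by
  refine le_antisymm ((Subgroup.closure_le H).2 (h.swapSet_subset _)) fun f hf => ?_
  obtain ⟨D, h1, h2⟩ := exists_definedFrom (h.le_G31 hf)
  exact (h.wordOn_of_definedFrom hf h1 h2).mem_closure

end Coloring

/-! ### Colourings of the three groups -/

theorem DefinedFrom.mem_G31 {f : BigG31} {D : ℕ} (h1 : DefinedFrom D f)
    (h2 : DefinedFrom D f⁻¹) : f ∈ G31 := by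
  have h3 := (isFinGen_iff f.iso.domain_ideal f.ess_domain).2 ⟨D, h1⟩
  refine ⟨h3, (isFinGen_iff f.iso.image_ideal f.ess_image).2 ⟨D, fun y hy => ?_⟩⟩
  obtain ⟨x, hx⟩ := h2 y hy
  exact ⟨x, BigG.mem_inv.1 hx⟩

theorem swap_mem_G31 {u v : List Letter} (h : Inc u v) : swap u v ∈ G31 := by
  have : DefinedFrom (u.length + v.length) (swap u v) := by
    intro x hx
    obtain ⟨y, hy⟩ := SwapRel.cover u v x (by omega) (by omega)
    exact ⟨y, mem_swap h hy⟩
  exact this.mem_G31 (by rwa [swap_inv h])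

/-- Appending `N` zeros to a binary word lengthens its image by the same zeros, so both conditions
descend from long words to all words of the domain. -/
theorem mem_G31mod_of_long {f : BigG31} (hf : f ∈ G31) (N : ℕ)
    (h1 : ∀ x ∈ binaryWords, N ≤ x.length →
      ∃ y ∈ binaryWords, y ∈ f.map x ∧ y.length ≡ x.length [MOD 3])
    (h2 : ∀ x ∈ binaryWords, N ≤ x.length → ∃ y ∈ binaryWords, y ∈ f⁻¹.map x) : f ∈ G31mod := by
  have hr : bits (List.replicate N false) ∈ binaryWords := ⟨_, rfl⟩
  have hl : (bits (List.replicate N false)).length = N := by simp [bits]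
  refine ⟨hf, fun x hx y hy => ?_, fun x hx y hy => ?_, fun x hx y hy => ?_⟩
  · obtain ⟨z, hz, h, -⟩ := h1 _ (append_mem_binaryWords.2 ⟨hx, hr⟩) (by simp [hl])
    rw [Option.mem_unique h (f.iso _ _ _ hy)] at hz
    exact (append_mem_binaryWords.1 hz).1
  · obtain ⟨z, hz, h⟩ := h2 _ (append_mem_binaryWords.2 ⟨hx, hr⟩) (by simp [hl])
    rw [Option.mem_unique h (f⁻¹.iso _ _ _ hy)] at hz
    exact (append_mem_binaryWords.1 hz).1
  · obtain ⟨z, hz, h, hm⟩ := h1 _ (append_mem_binaryWords.2 ⟨hx, hr⟩) (by simp [hl])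
    rw [Option.mem_unique h (f.iso _ _ _ hy), List.length_append, List.length_append] at hm
    exact Nat.ModEq.add_right_cancel' _ hm

open Classical in
/-- The colour of a word: the length modulo 3 of a binary word, and 3 for all other words. -/
noncomputable def color (x : List Letter) : ℕ := if x ∈ binaryWords then x.length % 3 else 3

theorem color_binary {x : List Letter} (h : x ∈ binaryWords) : color x = x.length % 3 := if_pos h

theorem color_not_binary {x : List Letter} (h : x ∉ binaryWords) : color x = 3 := if_neg h

theorem color_cases (x : List Letter) : color x < 3 ∧ x ∈ binaryWords ∨
    color x = 3 ∧ x ∉ binaryWords := by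
  by_cases h : x ∈ binaryWords
  · exact Or.inl ⟨by rw [color_binary h]; omega, h⟩
  · exact Or.inr ⟨color_not_binary h, h⟩

theorem binary_iff_of_color_eq {x y : List Letter} (h : color x = color y) :
    x ∈ binaryWords ↔ y ∈ binaryWords := by
  rcases color_cases x with ⟨h1, h2⟩ | ⟨h1, h2⟩ <;> rcases color_cases y with ⟨h3, h4⟩ | ⟨h3, h4⟩
  · exact iff_of_true h2 h4
  · omega
  · omega
  · exact iff_of_false h2 h4

theorem color_append {x y : List Letter} (h : color x = color y) (z : List Letter) :
    color (x ++ z) = color (y ++ z) := by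
  by_cases hz : x ++ z ∈ binaryWords
  · obtain ⟨h1, h2⟩ := append_mem_binaryWords.1 hz
    have h3 := (binary_iff_of_color_eq h).1 h1
    rw [color_binary hz, color_binary (append_mem_binaryWords.2 ⟨h3, h2⟩)]
    rw [color_binary h1, color_binary h3] at h
    simp only [List.length_append]
    omega
  · rw [color_not_binary hz, color_not_binary]
    rw [append_mem_binaryWords] at *
    rwa [← binary_iff_of_color_eq h]

theorem SwapRel.color_eq {u v x y : List Letter} (h : color u = color v) (hr : SwapRel u v x y) :
    color y = color x := by
  rcases hr with ⟨z, rfl, rfl⟩ | ⟨z, rfl, rfl⟩ | ⟨rfl, -⟩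
  · exact (color_append h z).symm
  · exact color_append h z
  · rfl

theorem modEq_of_color_eq {x y : List Letter} (h : color y = color x) (hx : x ∈ binaryWords) :
    y.length ≡ x.length [MOD 3] := by
  have hy := (binary_iff_of_color_eq h).2 hx
  rw [color_binary hx, color_binary hy] at h
  exact h

theorem swap_mem_G31mod {u v : List Letter} (h : Inc u v) (hc : color u = color v) :
    swap u v ∈ G31mod := by
  have key : ∀ x ∈ binaryWords, u.length + v.length ≤ x.length →
      ∃ y ∈ binaryWords, y ∈ (swap u v).map x ∧ y.length ≡ x.length [MOD 3] := by
    intro x hx hl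
    obtain ⟨y, hy⟩ := SwapRel.cover u v x (by omega) (by omega)
    have := hy.color_eq hc
    exact ⟨y, (binary_iff_of_color_eq this).2 hx, mem_swap h hy, modEq_of_color_eq this hx⟩
  refine mem_G31mod_of_long (swap_mem_G31 h) _ key fun x hx hl => ?_
  rw [swap_inv h]
  obtain ⟨y, hy, hxy, -⟩ := key x hx hl
  exact ⟨y, hy, hxy⟩

theorem none_notMem_bits (b : List Bool) : none ∉ bits b := by simp [bits]

theorem exists_bits_hash_of_not_binary {x : List Letter} (h : x ∉ binaryWords) :
    ∃ b w, x = bits b ++ none :: w := by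
  induction x with
  | nil => exact (h ⟨[], rfl⟩).elim
  | cons a t ih =>
    rcases a with _ | c
    · exact ⟨[], t, rfl⟩
    · obtain ⟨b, w, rfl⟩ := ih (by
        rintro ⟨b, rfl⟩
        exact h ⟨c :: b, rfl⟩)
      exact ⟨c :: b, w, rfl⟩

theorem hashed_not_binary {x : List Letter} (h : x ∈ hashedWords) : x ∉ binaryWords := by
  rintro ⟨c, rfl⟩
  obtain ⟨b, hb⟩ := h
  exact none_notMem_bits c (hb ▸ by simp)

/-- The binary words and the binary words followed by `#`. -/
def plainWords : Set (List Letter) := binaryWords ∪ hashedWords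

theorem eq_nil_of_hashed_append {x z : List Letter} (hx : x ∈ hashedWords)
    (h : x ++ z ∈ plainWords) : z = [] := by
  obtain ⟨b, rfl⟩ := hx
  rcases h with h | ⟨c, hc⟩
  · exact (hashed_not_binary ⟨b, rfl⟩ (append_mem_binaryWords.1 h).1).elim
  · exact (bits_append_inj (b := b) (b' := c) (w := z) (w' := []) (by simpa using hc)).2

theorem binary_append_hashed {x z : List Letter} (hx : x ∈ binaryWords)
    (h : x ++ z ∈ hashedWords) : z ∈ hashedWords := by
  obtain ⟨b, rfl⟩ := hx
  obtain ⟨c, hc⟩ := h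
  induction b generalizing c with
  | nil => exact ⟨c, by simpa [bits] using hc⟩
  | cons a t ih =>
    cases c with
    | nil => simp [bits] at hc
    | cons d c =>
      refine ih c ?_
      simp only [bits, List.map_cons, List.cons_append, List.cons.injEq] at hc
      exact hc.2

theorem append_hashed {x z : List Letter} (hx : x ∈ binaryWords)
    (h : z ∈ hashedWords) : x ++ z ∈ hashedWords := by
  obtain ⟨b, rfl⟩ := hx
  obtain ⟨c, rfl⟩ := h
  exact ⟨b ++ c, by simp [bits]⟩

theorem plain_append {u v w : List Letter} (hu : u ∈ plainWords) (hv : v ∈ plainWords)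
    (hc : color u = color v) (h : u ++ w ∈ plainWords) : v ++ w ∈ plainWords := by
  rcases hu with hu | hu
  · have hv' := (binary_iff_of_color_eq hc).1 hu
    rcases h with h | h
    · exact Or.inl (append_mem_binaryWords.2 ⟨hv', (append_mem_binaryWords.1 h).2⟩)
    · exact Or.inr (append_hashed hv' (binary_append_hashed hu h))
  · rwa [eq_nil_of_hashed_append hu h, List.append_nil]

theorem hashed_of_plain {x : List Letter} (h : x ∈ plainWords) (h' : x ∉ binaryWords) :
    x ∈ hashedWords := h.resolve_left h'

/-- Plain words matter here: no plain word properly extends a word of `{0,1}*#`, so the exchange is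
defined on all of `{0,1}*#`. -/
theorem swap_mem_G31modHash {u v : List Letter} (hu : u ∈ plainWords) (hv : v ∈ plainWords)
    (h : Inc u v) (hc : color u = color v) : swap u v ∈ G31modHash := by
  have hpre : ∀ x ∈ hashedWords, ∀ u ∈ plainWords, u <+: x ∨ Inc u x := by
    intro x hx u hu
    by_cases h1 : u <+: x
    · exact Or.inl h1
    · refine Or.inr ⟨h1, ?_⟩
      rintro ⟨z, rfl⟩
      rw [eq_nil_of_hashed_append hx hu, List.append_nil] at h1
      exact h1 List.prefix_rfl
  have key : ∀ x ∈ hashedWords, ∃ y ∈ hashedWords, y ∈ (swap u v).map x := by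
    intro x hx
    obtain ⟨y, hy, hp⟩ : ∃ y, SwapRel u v x y ∧ y ∈ plainWords := by
      rcases hpre x hx u hu with ⟨z, rfl⟩ | h1
      · exact ⟨_, Or.inl ⟨z, rfl, rfl⟩, plain_append hu hv hc (Or.inr hx)⟩
      rcases hpre x hx v hv with ⟨z, rfl⟩ | h2
      · exact ⟨_, Or.inr (Or.inl ⟨z, rfl, rfl⟩), plain_append hv hu hc.symm (Or.inr hx)⟩
      · exact ⟨x, Or.inr (Or.inr ⟨rfl, h1, h2⟩), Or.inr hx⟩
    refine ⟨y, hashed_of_plain hp ?_, mem_swap h hy⟩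
    rw [binary_iff_of_color_eq (hy.color_eq hc)]
    exact hashed_not_binary hx
  exact ⟨swap_mem_G31mod h hc, key, by rwa [swap_inv h]⟩

theorem color_eq_of_mem_G31mod {f : BigG31} (hf : f ∈ G31mod) {x y : List Letter}
    (hy : y ∈ f.map x) : color y = color x := by
  by_cases hx : x ∈ binaryWords
  · rw [color_binary hx, color_binary (hf.2.1 x hx y hy)]
    exact hf.2.2.2 x hx y hy
  · rw [color_not_binary hx, color_not_binary]
    exact fun h => hx (hf.2.2.1 y h x (BigG.mem_inv.2 hy))

theorem color_append_some (x : List Letter) (c : Bool) :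
    color (x ++ [some c]) = if color x = 3 then 3 else (color x + 1) % 3 := by
  have hc : [some c] ∈ binaryWords := ⟨[c], rfl⟩
  rcases color_cases x with ⟨h1, h2⟩ | ⟨h1, h2⟩
  · rw [if_neg (by omega), color_binary (append_mem_binaryWords.2 ⟨h2, hc⟩), color_binary h2]
    simp
  · rw [if_pos h1, color_not_binary]
    exact fun h => h2 (append_mem_binaryWords.1 h).1

theorem color_append_none (x : List Letter) : color (x ++ [none]) = 3 :=
  color_not_binary fun h => by simpa using mem_binaryWords.1 (append_mem_binaryWords.1 h).2

open Finset in
theorem card_children_color (x : List Letter) (t : ℕ) : #{a : Letter | color (x ++ [a]) = t} =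
    (if t = 3 then 1 else 0) +
      2 * if (if color x = 3 then 3 else (color x + 1) % 3) = t then 1 else 0 := by
  rw [card_filter, Fintype.sum_option, Fintype.sum_bool, color_append_none, color_append_some,
    color_append_some]
  simp only [eq_comm (a := 3) (b := t)]
  ring

-- The four colour classes satisfy a linear system. Its part for colours 0, 1, 2 is cyclic with
-- determinant `1 - 2^3 ≠ 0`, and colour 3 is then determined by the rest.
open Finset in
theorem card_filter_color_eq {I J : Finset (List Letter)} (hI : PrefixClosed I)
    (hJ : PrefixClosed J)
    (h : ∀ t, #{x ∈ leaves I | color x = t} = #{x ∈ leaves J | color x = t}) (t : ℕ) :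
    #{x ∈ I | color x = t} = #{x ∈ J | color x = t} := by
  have hle : ∀ x, color x ≤ 3 := fun x => by rcases color_cases x with h | h <;> omega
  have e : ∀ (I : Finset (List Letter)), PrefixClosed I →
      #{x ∈ leaves I | color x = 0} + #{x ∈ I | color x = 0} =
        1 + 2 * #{x ∈ I | color x = 2} ∧
      #{x ∈ leaves I | color x = 1} + #{x ∈ I | color x = 1} = 2 * #{x ∈ I | color x = 0} ∧
      #{x ∈ leaves I | color x = 2} + #{x ∈ I | color x = 2} = 2 * #{x ∈ I | color x = 1} ∧
      #{x ∈ leaves I | color x = 3} + #{x ∈ I | color x = 3} =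
        #{x ∈ I | color x = 0} + #{x ∈ I | color x = 1} + #{x ∈ I | color x = 2} +
          3 * #{x ∈ I | color x = 3} := by
    intro I hI
    have h0 : color [] = 0 := color_binary ⟨[], rfl⟩
    have hs : ∀ (t : ℕ) (F : ℕ → ℕ), (∀ r ≤ 3, (if t = 3 then 1 else 0) +
        2 * (if (if r = 3 then 3 else (r + 1) % 3) = t then 1 else 0) = F r) →
        ∑ x ∈ I, #{a : Letter | color (x ++ [a]) = t} = ∑ x ∈ I, F (color x) :=
      fun t F hF => sum_congr rfl fun x _ => by rw [card_children_color, hF _ (hle x)]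
    refine ⟨?_, ?_, ?_, ?_⟩ <;> rw [card_filter_leaves hI, h0]
    · rw [hs 0 (fun r => 2 * if r = 2 then 1 else 0) (by decide)]
      simp only [if_true, card_filter, mul_sum]
    · rw [hs 1 (fun r => 2 * if r = 0 then 1 else 0) (by decide)]
      simp only [card_filter, mul_sum, zero_ne_one, if_false, zero_add]
    · rw [hs 2 (fun r => 2 * if r = 1 then 1 else 0) (by decide), if_neg (by decide)]
      simp only [card_filter, mul_sum, zero_add]
    · rw [hs 3 (fun r => (if r = 0 then 1 else 0) + (if r = 1 then 1 else 0) +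
        (if r = 2 then 1 else 0) + 3 * if r = 3 then 1 else 0) (by decide), if_neg (by decide)]
      simp only [card_filter, mul_sum, sum_add_distrib, zero_add]
  obtain ⟨a0, a1, a2, a3⟩ := e I hI
  obtain ⟨b0, b1, b2, b3⟩ := e J hJ
  rw [h] at a0 a1 a2 a3
  by_cases ht : t ≤ 3
  · interval_cases t <;> omega
  · rw [filter_eq_empty_iff.2 fun x _ => by have := hle x; omega,
      filter_eq_empty_iff.2 fun x _ => by have := hle x; omega]

theorem inc_of_getElem? {A : Type*} {u v : List A} {a b : A} (i : ℕ) (hu : u[i]? = some a)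
    (hv : v[i]? = some b) (h : a ≠ b) : Inc u v := by
  have key : ∀ {u v : List A} {a b : A}, u[i]? = some a → v[i]? = some b → a ≠ b → ¬ u <+: v := by
    rintro u v a b hu hv h ⟨t, rfl⟩
    obtain ⟨hi, -⟩ := List.getElem?_eq_some_iff.1 hu
    rw [List.getElem?_append_left hi, hu] at hv
    exact h (Option.some.inj hv)
  exact ⟨key hu hv h, key hv hu h.symm⟩

/-- A long word has a prefix that can be exchanged with a shorter word of the same colour, away
from a given word. -/
theorem exists_shorter (u : List Letter) (hu : 7 ≤ u.length) (v : List Letter) (hv : v ≠ []) :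
    ∃ a b, a <+: u ∧ color a = color b ∧ a.length ≤ 7 ∧ b.length < a.length ∧ Inc a b ∧ Inc b v ∧
      (u ∈ plainWords → a ∈ plainWords ∧ b ∈ plainWords) := by
  match u, hu with
  | u0 :: u1 :: u2 :: u3 :: u4 :: u5 :: u6 :: u', _ =>
  match v, hv with
  | v0 :: v', _ =>
  -- The first letter of `b` separates it from `v`, the second from `u`.
  obtain ⟨c, hc⟩ : ∃ c : Bool, some c ≠ v0 := by
    rcases v0 with _ | _ | _
    exacts [⟨true, by simp⟩, ⟨true, by simp⟩, ⟨false, by simp⟩]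
  obtain ⟨d, hd⟩ : ∃ d : Bool, u1 ≠ some d := by
    rcases u1 with _ | _ | _
    exacts [⟨true, by simp⟩, ⟨true, by simp⟩, ⟨false, by simp⟩]
  have hb : bits [c, d, false] ∈ binaryWords := ⟨_, rfl⟩
  -- Lengths 6 and 3 agree modulo 3, so binary prefixes need no more; a non-binary prefix matches
  -- any word that contains `#`.
  by_cases h : [u0, u1, u2, u3, u4, u5] ∈ binaryWords
  · refine ⟨[u0, u1, u2, u3, u4, u5], bits [c, d, false], ⟨u6 :: u', rfl⟩, ?_, by simp,
      by simp [bits], inc_of_getElem? 1 rfl rfl hd, inc_of_getElem? 0 rfl rfl hc,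
      fun _ => ⟨Or.inl h, Or.inl hb⟩⟩
    rw [color_binary h, color_binary hb]
    simp [bits]
  · have h' : [u0, u1, u2, u3, u4, u5, u6] ∉ binaryWords := fun h1 =>
      h (append_mem_binaryWords (y := [u6]) |>.1 h1).1
    refine ⟨[u0, u1, u2, u3, u4, u5, u6], bits [c, d, false] ++ [none], ⟨u', rfl⟩, ?_, by simp,
      by simp [bits], inc_of_getElem? 1 rfl rfl hd, inc_of_getElem? 0 rfl rfl hc, fun h1 => ?_⟩
    · rw [color_not_binary h', color_append_none]
    · rcases h1 with h1 | ⟨b, hb⟩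
      · exact (h (append_mem_binaryWords (x := [u0, u1, u2, u3, u4, u5]) |>.1 h1).1).elim
      -- In a plain word `#` can only be the last letter, so the first six of at least seven letters
      -- are bits.
      · exfalso
        have h2 := congrArg List.dropLast hb
        rw [List.dropLast_concat] at h2
        refine h (append_mem_binaryWords (y := (u6 :: u').dropLast) |>.1 ⟨b, h2.symm.trans ?_⟩).1
        rfl

theorem coloring_G31 : Coloring G31 Set.univ Set.univ (fun _ => 0) where
  le_G31 := le_rfl
  nil_adm := trivial
  inn_adm := fun _ _ => trivial
  child_adm := fun _ _ _ => trivial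
  undefined := fun _ _ _ _ => trivial
  color := fun _ _ _ _ _ _ => rfl
  swap_mem := fun _ _ _ _ _ h => swap_mem_G31 h
  congr_inn := fun _ _ _ _ _ _ _ => trivial
  congr_adm := fun _ _ _ _ _ _ _ => ⟨trivial, rfl⟩
  count := by
    intro I J hI hJ _ _ h t
    have h1 := card_filter_leaves hI (fun _ => 0) t
    have h2 := card_filter_leaves hJ (fun _ => 0) t
    have h3 := h t
    by_cases ht : 0 = t
    · simp only [ht, Finset.filter_true, Finset.sum_const, Finset.card_univ, if_true,
        Fintype.card_option, Fintype.card_bool, smul_eq_mul] at *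
      omega
    · simp [ht]
  shorten := by
    intro u _ hl v hv
    obtain ⟨a, b, h1, -, h2, h3, h4, h5, -⟩ := exists_shorter u hl v hv
    exact ⟨a, trivial, b, trivial, h1, rfl, h2, h3, h4, h5⟩

theorem coloring_G31mod : Coloring G31mod Set.univ Set.univ color where
  le_G31 := fun _ h => h.1
  nil_adm := trivial
  inn_adm := fun _ _ => trivial
  child_adm := fun _ _ _ => trivial
  undefined := fun _ _ _ _ => trivial
  color := fun _ hf _ _ _ hy => color_eq_of_mem_G31mod hf hy
  swap_mem := fun _ _ _ _ hc h => swap_mem_G31mod h hc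
  congr_inn := fun _ _ _ _ _ _ _ => trivial
  congr_adm := fun _ _ _ _ h w _ => ⟨trivial, (color_append h w).symm⟩
  count := fun _ _ hI hJ _ _ h => card_filter_color_eq hI hJ h
  shorten := by
    intro u _ hl v hv
    obtain ⟨a, b, h1, h6, h2, h3, h4, h5, -⟩ := exists_shorter u hl v hv
    exact ⟨a, trivial, b, trivial, h1, h6, h2, h3, h4, h5⟩

/-- Being defined on `{0,1}*#`, an element is defined at every word that contains `#`; hence the
inner vertices are binary and the leaves are plain. -/
theorem coloring_G31modHash : Coloring G31modHash binaryWords plainWords color where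
  le_G31 := fun _ h => h.1.1
  nil_adm := Or.inl ⟨[], rfl⟩
  inn_adm := fun _ h => Or.inl h
  child_adm := by
    rintro x hx (_ | c)
    · exact Or.inr (append_hashed hx ⟨[], rfl⟩)
    · exact Or.inl (append_mem_binaryWords.2 ⟨hx, [c], rfl⟩)
  undefined := by
    intro f hf x hx
    by_contra h
    obtain ⟨b, w, hw⟩ := exists_bits_hash_of_not_binary h
    obtain ⟨y, -, hy⟩ := hf.2.1 (bits b ++ [none]) ⟨b, rfl⟩
    have := f.iso _ _ w hy
    rw [List.append_assoc, List.singleton_append, ← hw] at this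
    exact hx ⟨_, this⟩
  color := fun _ hf _ _ _ hy => color_eq_of_mem_G31mod hf.1 hy
  swap_mem := fun _ hu _ hv hc h => swap_mem_G31modHash hu hv h hc
  congr_inn := fun u _ v hv _ w hw =>
    append_mem_binaryWords.2 ⟨hv, (append_mem_binaryWords.1 hw).2⟩
  congr_adm := fun _ hu _ hv h w hw => ⟨plain_append hu hv h hw, (color_append h w).symm⟩
  count := fun _ _ hI hJ _ _ h => card_filter_color_eq hI hJ h
  shorten := by
    intro u hu hl v hv
    obtain ⟨a, b, h1, h6, h2, h3, h4, h5, h7⟩ := exists_shorter u hl v hv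
    exact ⟨a, (h7 hu).1, b, (h7 hu).2, h1, h6, h2, h3, h4, h5⟩

/-! ### Locality and linear depth -/

/-- Two words that differ by inner binary factors whose lengths agree modulo 3, at distance at
least `m` from both ends. -/
def Similar (m : ℕ) (w w' : List Letter) : Prop :=
  ∃ (a b : List Letter) (s s' : List Bool), w = a ++ (bits s ++ b) ∧ w' = a ++ (bits s' ++ b) ∧
    m ≤ a.length ∧ m ≤ b.length ∧ s.length ≡ s'.length [MOD 3]

/-- `f` acts in the same way behind similar words, at the cost `c` in the distance to the ends. -/
def Local (c : ℕ) (f : BigG31) : Prop :=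
  ∀ m w w', Similar (m + c) w w' → ∃ p p', Similar m p p' ∧
    ∀ v, ∃ z y, p ++ y ∈ f.map (w ++ v ++ z) ∧ p' ++ y ∈ f.map (w' ++ v ++ z)

theorem Similar.mono {m n : ℕ} {w w' : List Letter} (h : Similar n w w') (hmn : m ≤ n) :
    Similar m w w' := by
  obtain ⟨a, b, s, s', h1, h2, h3, h4, h5⟩ := h
  exact ⟨a, b, s, s', h1, h2, hmn.trans h3, hmn.trans h4, h5⟩

theorem Local.mono {c d : ℕ} {f : BigG31} (h : Local c f) (hcd : c ≤ d) : Local d f :=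
  fun m w w' hw => h m w w' (hw.mono (by omega))

theorem Local.one : Local 0 1 := fun _ w w' hw =>
  ⟨w, w', hw, fun v => ⟨[], v, BigG.mem_one.2 (by simp), BigG.mem_one.2 (by simp)⟩⟩

/-- The common suffix `y` produced by `g` serves as the continuation for `f`. This is why `Local`
quantifies over every `v` and allows a further `z`. -/
theorem Local.mul {c d : ℕ} {f g : BigG31} (hf : Local c f) (hg : Local d g) :
    Local (c + d) (f * g) := by
  intro m w w' hw
  obtain ⟨p, p', hp, h1⟩ := hg (m + c) w w' (by rwa [add_assoc])
  obtain ⟨q, q', hq, h2⟩ := hf m p p' hp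
  refine ⟨q, q', hq, fun v => ?_⟩
  obtain ⟨z, y, h3, h4⟩ := h1 v
  obtain ⟨t, x, h5, h6⟩ := h2 y
  refine ⟨z ++ t, x, ?_, ?_⟩
  · rw [← List.append_assoc]
    exact BigG.mem_mul (g.iso _ _ t h3) h5
  · rw [← List.append_assoc]
    exact BigG.mem_mul (g.iso _ _ t h4) h6

theorem similar_of_prefix {m : ℕ} {q b : List Letter} {s s' : List Bool} (hq : m ≤ q.length)
    (hb : m ≤ b.length) (hs : s.length ≡ s'.length [MOD 3]) :
    Similar m (q ++ (bits s ++ b)) (q ++ (bits s' ++ b)) :=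
  ⟨q, b, s, s', rfl, rfl, hq, hb, hs⟩

/-- Only the first `D` letters are rewritten, and these belong to the common left part. -/
theorem DefinedFrom.local {D : ℕ} {f : BigG31} (h : DefinedFrom D f) : Local D f := by
  rintro m _ _ ⟨a, b, s, s', rfl, rfl, ha, hb, hs⟩
  obtain ⟨y, hy⟩ := h (a.take D) (by simp; omega)
  have hy' := f.iso _ _ (a.drop D) hy
  rw [List.take_append_drop] at hy'
  refine ⟨_, _, similar_of_prefix (q := y ++ a.drop D) (b := b) (m := m)
    (by simp; omega) (by omega) hs, fun v => ⟨[], v, ?_, ?_⟩⟩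
  · simpa using f.iso _ _ (bits s ++ b ++ v) hy'
  · simpa using f.iso _ _ (bits s' ++ b ++ v) hy'

theorem bits_append (a b : List Bool) : bits (a ++ b) = bits a ++ bits b := by simp [bits]

theorem length_bits (a : List Bool) : (bits a).length = a.length := by simp [bits]

/-- A map `x # w ↦ x' # w`, where `x'` arises from `x` by permuting the blocks of three bits
behind the first `i` bits, is local. -/
theorem local_of_blocks {f : BigG31} (i : ℕ) (ρ : List Bool → List Bool)
    (hlen : ∀ l, (ρ l).length = l.length)
    (hadd : ∀ s r, 3 ∣ s.length → ρ (s ++ r) = ρ s ++ ρ r)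
    (hf : ∀ b w, bits (b.take i ++ ρ (b.drop i)) ++ none :: w ∈ f.map (bits b ++ none :: w)) :
    Local (i + 4) f := by
  rintro m _ _ ⟨a, b, s, s', rfl, rfl, ha, hb, hs⟩
  -- If `a` contains `#`, everything behind that `#` stays fixed, in particular the place where the
  -- two words differ.
  by_cases haB : a ∈ binaryWords
  swap
  · obtain ⟨x, a', rfl⟩ := exists_bits_hash_of_not_binary haB
    have hy := hf x a'
    refine ⟨_, _, similar_of_prefix (b := b) (m := m)
      (q := bits (x.take i ++ ρ (x.drop i)) ++ none :: a') ?_ (by omega) hs,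
      fun v => ⟨[], v, ?_, ?_⟩⟩
    · simp only [List.length_append, List.length_cons, length_bits, hlen, List.length_take,
        List.length_drop] at ha ⊢
      omega
    · simpa using f.iso _ _ (bits s ++ b ++ v) hy
    · simpa using f.iso _ _ (bits s' ++ b ++ v) hy
  obtain ⟨x, rfl⟩ := haB
  rw [length_bits] at ha
  -- `x1` ends at a block boundary; the at most two bits of `x2` join the differing factor.
  obtain ⟨x1, x2, rfl, hx1, hx1', hx2⟩ : ∃ x1 x2 : List Bool, x = x1 ++ x2 ∧ i ≤ x1.length ∧
      3 ∣ x1.length - i ∧ x2.length ≤ 2 := by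
    refine ⟨x.take (x.length - (x.length - i) % 3), x.drop (x.length - (x.length - i) % 3),
      by simp, ?_, ?_, ?_⟩ <;>
    simp only [List.length_take, List.length_drop] <;> omega
  set X := x1.take i ++ ρ (x1.drop i) with hX
  have hXlen : X.length = x1.length := by
    simp only [hX, List.length_append, hlen, List.length_take, List.length_drop]
    omega
  have hf' : ∀ r w, bits X ++ bits (ρ r) ++ none :: w ∈ f.map (bits x1 ++ bits r ++ none :: w) := by
    intro r w
    have := hf (x1 ++ r) w
    rw [List.take_append_of_le_length hx1, List.drop_append_of_le_length hx1, hadd _ _ (by simpa),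
      ← List.append_assoc, ← hX, bits_append, bits_append] at this
    exact this
  simp only [List.length_append] at ha
  have hS : (x2 ++ s).length ≡ (x2 ++ s').length [MOD 3] := by
    simpa using Nat.ModEq.add_left _ hs
  -- The number of bits of `b` needed to complete the last block of the differing factor. It is the
  -- same for `s` and `s'`, so the blocks behind it coincide.
  set k := (3 - (x2 ++ s).length % 3) % 3 with hk
  have hsplit : ∀ S d : List Bool, S.length ≡ (x2 ++ s).length [MOD 3] →
      ρ (S ++ d) = ρ (S ++ d.take k) ++ ρ (d.drop k) := by
    intro S d hS
    unfold Nat.ModEq at hS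
    by_cases hd : k ≤ d.length
    · rw [← hadd, List.append_assoc, List.take_append_drop]
      rw [List.length_append, List.length_take]
      omega
    · have h0 : ρ [] = [] := List.eq_nil_of_length_eq_zero (hlen [])
      rw [List.drop_of_length_le (by omega), List.take_of_length_le (by omega), h0,
        List.append_nil]
  have hk2 : k ≤ 2 := by omega
  have hρ : ∀ d : List Bool, (ρ (x2 ++ s ++ d)).length ≡ (ρ (x2 ++ s' ++ d)).length [MOD 3] := by
    intro d
    rw [hlen, hlen, List.length_append, List.length_append (as := x2 ++ s')]
    exact Nat.ModEq.add_right _ hS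
  by_cases hbB : b ∈ binaryWords
  · obtain ⟨d, rfl⟩ := hbB
    rw [length_bits] at hb
    -- The complete blocks of `b` form the new right part. At most two bits are lost on each of its
    -- sides, hence the 4 in the cost; the unfinished block `e2` depends on the continuation.
    set e1 := (d.drop k).take (3 * ((d.drop k).length / 3)) with he1
    set e2 := (d.drop k).drop (3 * ((d.drop k).length / 3)) with he2
    have he1' : e1.length = 3 * ((d.length - k) / 3) := by
      simp only [he1, List.length_take, List.length_drop]
      omega
    have he : d.drop k = e1 ++ e2 := by simp [he1, he2]
    have hsplit2 : ∀ S β : List Bool, S.length ≡ (x2 ++ s).length [MOD 3] →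
        ρ (S ++ (d ++ β)) = ρ (S ++ d.take k) ++ ρ e1 ++ ρ (e2 ++ β) := by
      intro S β hS
      rw [hsplit S _ hS, List.take_append_of_le_length (by omega),
        List.drop_append_of_le_length (by omega), he, List.append_assoc e1,
        hadd e1 _ (by omega), List.append_assoc]
    refine ⟨_, _, similar_of_prefix (q := bits X) (b := bits (ρ e1)) (m := m)
      (by rw [length_bits]; omega) (by rw [length_bits, hlen]; omega) (hρ (d.take k)),
      fun v => ?_⟩
    obtain ⟨β, z, ω, hv⟩ := exists_bits_hash v
    refine ⟨z, bits (ρ (e2 ++ β)) ++ none :: ω, ?_, ?_⟩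
    · have := hf' (x2 ++ s ++ (d ++ β)) ω
      rw [hsplit2 _ _ rfl] at this
      simpa [bits_append, hv] using this
    · have := hf' (x2 ++ s' ++ (d ++ β)) ω
      rw [hsplit2 _ _ hS.symm] at this
      simpa [bits_append, hv] using this
  · obtain ⟨d, b', rfl⟩ := exists_bits_hash_of_not_binary hbB
    simp only [List.length_append, length_bits, List.length_cons] at hb
    refine ⟨_, _, similar_of_prefix (q := bits X) (b := bits (ρ (d.drop k)) ++ none :: b') (m := m)
      (by rw [length_bits]; omega) ?_ (hρ (d.take k)), fun v => ⟨[], v, ?_, ?_⟩⟩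
    · simp only [List.length_append, length_bits, List.length_cons, hlen, List.length_drop]
      omega
    · have := hf' (x2 ++ s ++ d) (b' ++ v)
      rw [hsplit _ _ rfl] at this
      simpa [bits_append] using this
    · have := hf' (x2 ++ s' ++ d) (b' ++ v)
      rw [hsplit _ _ hS.symm] at this
      simpa [bits_append] using this

theorem length_rot (l : List Bool) : (rot l).length = l.length := by
  induction l using rot.induct with
  | case1 a b c t ih => simp [rot, ih]
  | case2 t h =>
    rw [rot]
    exact h

theorem length_rotInv (l : List Bool) : (rotInv l).length = l.length := by
  rw [← length_rot (rotInv l), rot_rotInv]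

theorem rot_append (s r : List Bool) (h : 3 ∣ s.length) : rot (s ++ r) = rot s ++ rot r := by
  induction s using rot.induct with
  | case1 a b c t ih =>
    simp only [List.length_cons] at h
    simp [rot, ih (by omega)]
  | case2 t ht =>
    match t, h, ht with
    | [], _, _ => simp [rot]
    | [_], h, _ => simp at h
    | [_, _], h, _ => simp at h
    | a :: b :: c :: t, _, ht => exact (ht a b c t rfl).elim

theorem rotInv_append (s r : List Bool) (h : 3 ∣ s.length) :
    rotInv (s ++ r) = rotInv s ++ rotInv r := by
  rw [← rotInv_rot (rotInv s ++ rotInv r), rot_append _ _ (by rwa [length_rotInv]), rot_rotInv,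
    rot_rotInv]

theorem mem_kappa (i : ℕ) (b : List Bool) (w : List Letter) :
    bits (kappaBits i b) ++ none :: w ∈ (kappa i).map (bits b ++ none :: w) :=
  (kappaIso i).map_le_maxMap _ _ (mem_kappaIso.2 ⟨b, w, rfl, rfl⟩)

theorem local_kappa (i : ℕ) : Local (i + 4) (kappa i) :=
  local_of_blocks i rot length_rot rot_append (mem_kappa i)

theorem local_kappa_inv (i : ℕ) : Local (i + 4) (kappa i)⁻¹ := by
  refine local_of_blocks i rotInv length_rotInv rotInv_append fun b w => BigG.mem_inv.2 ?_
  have := mem_kappa i (kappaBitsInv i b) w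
  rwa [kappaBits_kappaBitsInv] at this

theorem exists_local {f : BigG31} (hf : f ∈ adjoinKappa G31) :
    ∃ c, Local c f ∧ Local c f⁻¹ := by
  induction hf using Subgroup.closure_induction with
  | mem x hx =>
    rcases hx with hx | rfl
    · obtain ⟨D, h1, h2⟩ := exists_definedFrom hx
      exact ⟨D, h1.local, h2.local⟩
    · refine ⟨18, ?_, ?_⟩
      · exact ((local_kappa 3).mul (local_kappa 2)).mul (local_kappa 1)
      · rw [kappa321, mul_inv_rev, mul_inv_rev]
        exact (local_kappa_inv 1).mul ((local_kappa_inv 2).mul (local_kappa_inv 3))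
  | one => exact ⟨0, .one, by rw [inv_one]; exact .one⟩
  | mul x y _ _ hx hy =>
    obtain ⟨c, h1, h2⟩ := hx
    obtain ⟨d, h3, h4⟩ := hy
    refine ⟨c + d, h1.mul h3, ?_⟩
    rw [mul_inv_rev, add_comm]
    exact h4.mul h2
  | inv x _ hx =>
    obtain ⟨c, h1, h2⟩ := hx
    exact ⟨c, h2, by rwa [inv_inv]⟩

/-- Membership in `G31` gives some depth `D` without control. Padding `u` in the middle reaches that
depth, and locality transfers definedness back to `u`. -/
theorem Local.definedFrom {g : BigG31} (hg : g ∈ G31) {c : ℕ} (h : Local c g) :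
    DefinedFrom (2 * c) g := by
  intro u hu
  obtain ⟨D, hD, -⟩ := exists_definedFrom hg
  obtain ⟨p, p', -, hp⟩ := h 0 u (u.take c ++ (bits (List.replicate (3 * D) false) ++ u.drop c))
    ⟨u.take c, u.drop c, [], List.replicate (3 * D) false, by simp [bits], rfl,
      by simp; omega, by simp; omega, by
        rw [List.length_replicate]
        exact (Nat.modEq_zero_iff_dvd.2 ⟨D, rfl⟩).symm⟩
  obtain ⟨q, hq⟩ := hD (u.take c ++ (bits (List.replicate (3 * D) false) ++ u.drop c))
    (by simp [bits]; omega)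
  have key : ∀ v, ∃ z y, p ++ y ∈ g.map (u ++ v ++ z) ∧ p' ++ y = q ++ (v ++ z) := by
    intro v
    obtain ⟨z, y, h1, h2⟩ := hp v
    have h3 := g.iso _ _ (v ++ z) hq
    rw [← List.append_assoc (bs := v)] at h3
    exact ⟨z, y, h1, Option.mem_unique h2 h3⟩
  -- If `p'` were strictly longer than `q`, it would prescribe the letter behind `q`; but `v` may
  -- start with any letter.
  have hpre : ∃ r, q = p' ++ r := by
    by_contra hcon
    have hnot : ∀ v, q ++ v ≠ p' ∨ v = [] := by
      intro v
      by_contra! hv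
      obtain ⟨h1, h2⟩ := hv
      obtain ⟨a, v, rfl⟩ := List.exists_cons_of_ne_nil h2
      obtain ⟨b, hb⟩ : ∃ b : Letter, b ≠ a := exists_ne a
      obtain ⟨z, y, -, h3⟩ := key [b]
      rw [← h1, List.append_assoc] at h3
      have := List.append_cancel_left h3
      simp at this
      exact hb this.1.symm
    obtain ⟨z, y, -, h3⟩ := key []
    rcases List.prefix_or_prefix_of_prefix (List.prefix_append p' y)
      (h3 ▸ List.prefix_append q _) with ⟨r, hr⟩ | ⟨r, hr⟩
    · exact hcon ⟨r, hr.symm⟩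
    · rcases hnot r with h4 | rfl
      · exact h4 hr
      · exact hcon ⟨[], by simpa using hr⟩
  obtain ⟨r, rfl⟩ := hpre
  refine ⟨p ++ r, BigG.mem_of_dense fun v => ?_⟩
  obtain ⟨z, y, h1, h2⟩ := key v
  rw [List.append_assoc] at h2
  refine ⟨z, ?_⟩
  rw [List.append_cancel_left h2] at h1
  simpa using h1

/-- Elements of the Thompson-Higman group have a depth at most linear in their word length over a
finite set of elements of the group generated by it and `κ_321`. -/
theorem exists_linear_depth {T : Set BigG31} (hT : T.Finite) (h : T ⊆ adjoinKappa G31) :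
    ∃ c, ∀ n g, WordOn T n g → g ∈ G31 → DefinedFrom (c * n) g ∧ DefinedFrom (c * n) g⁻¹ := by
  obtain ⟨c, hc⟩ := exists_uniform_bound hT (P := fun c f => Local c f ∧ Local c f⁻¹)
    (fun a b x hx hab => ⟨hx.1.mono hab, hx.2.mono hab⟩) fun s hs => exists_local (h hs)
  refine ⟨2 * c, fun n g hg hG => ?_⟩
  have key : ∀ g, WordOn T n g → Local (c * n) g := fun g hg =>
    WordOn.induction (P := Local) Local.one (fun a b x y hx hy => hx.mul hy) hc
      (fun a b x hx hab => hx.mono hab) hg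
  rw [mul_assoc]
  exact ⟨(key g hg).definedFrom hG, (key _ hg.inv).definedFrom (inv_mem hG)⟩

/-! ### Flips of remote bits -/

/-- The bit string with the bit at position `j` flipped. -/
def flipBit (j : ℕ) (b : List Bool) : List Bool := b.modify j not

theorem flipBit_flipBit (j : ℕ) (b : List Bool) : flipBit j (flipBit j b) = b := by
  induction j generalizing b with
  | zero => cases b <;> simp [flipBit]
  | succ j ih =>
    cases b with
    | nil => simp [flipBit]
    | cons a t => simpa [flipBit] using ih t

theorem length_flipBit (j : ℕ) (b : List Bool) : (flipBit j b).length = b.length := by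
  simp [flipBit]

theorem flipBit_append {j : ℕ} {b : List Bool} (h : j < b.length) (c : List Bool) :
    flipBit j (b ++ c) = flipBit j b ++ c := by
  induction j generalizing b with
  | zero => cases b <;> simp_all [flipBit]
  | succ j ih =>
    cases b with
    | nil => simp at h
    | cons a t => simpa [flipBit] using ih (b := t) (by simpa using h)

theorem flipBit_length_append (b : List Bool) (a : Bool) (c : List Bool) :
    flipBit b.length (b ++ a :: c) = b ++ (!a) :: c := by
  induction b with
  | nil => simp [flipBit]
  | cons d t ih => simpa [flipBit] using ih

theorem rot_flipBit (k : ℕ) (b : List Bool) (h : 3 * k + 3 ≤ b.length) :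
    rot (flipBit (3 * k) b) = flipBit (3 * k + 1) (rot b) := by
  induction k generalizing b with
  | zero =>
    match b, h with
    | x :: y :: z :: t, _ => simp [flipBit, rot]
  | succ k ih =>
    match b, h with
    | x :: y :: z :: t, h =>
      simp only [List.length_cons] at h
      have := ih t (by omega)
      simp only [flipBit] at *
      rw [show 3 * (k + 1) = 3 * k + 1 + 1 + 1 by ring]
      simp [rot, this]

theorem kappaBits_flipBit (i k : ℕ) (b : List Bool) (h : i + 3 * k + 3 ≤ b.length) :
    kappaBits i (flipBit (i + 3 * k) b) = flipBit (i + 3 * k + 1) (kappaBits i b) := by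
  induction i generalizing b with
  | zero => simpa [kappaBits] using rot_flipBit k b (by omega)
  | succ i ih =>
    match b, h with
    | a :: t, h =>
      simp only [List.length_cons] at h
      have := ih t (by omega)
      rw [show i + 1 + 3 * k = i + 3 * k + 1 by ring]
      simpa [kappaBits, flipBit] using this

theorem length_kappaBits (i : ℕ) (b : List Bool) : (kappaBits i b).length = b.length := by
  simp only [kappaBits, List.length_append, length_rot, List.length_take, List.length_drop]
  omega

/-- The permutation of bit strings that underlies `κ_321`. -/
def kappa321Bits (b : List Bool) : List Bool := kappaBits 3 (kappaBits 2 (kappaBits 1 b))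

theorem mem_kappa321 (b : List Bool) (w : List Letter) :
    bits (kappa321Bits b) ++ none :: w ∈ kappa321.map (bits b ++ none :: w) :=
  BigG.mem_mul (mem_kappa 1 b w) (BigG.mem_mul (mem_kappa 2 _ w) (mem_kappa 3 _ w))

theorem exists_kappa321Bits_eq (b : List Bool) : ∃ c, c.length = b.length ∧ kappa321Bits c = b := by
  have h : kappa321Bits (kappaBitsInv 1 (kappaBitsInv 2 (kappaBitsInv 3 b))) = b := by
    simp only [kappa321Bits, kappaBits_kappaBitsInv]
  refine ⟨_, ?_, h⟩
  rw [← congrArg List.length h]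
  simp only [kappa321Bits, length_kappaBits]

theorem kappa321Bits_flipBit (k : ℕ) (b : List Bool) (h : 3 * k + 6 ≤ b.length) :
    kappa321Bits (flipBit (3 * k + 1) b) = flipBit (3 * (k + 1) + 1) (kappa321Bits b) := by
  unfold kappa321Bits
  rw [show 3 * k + 1 = 1 + 3 * k by ring, kappaBits_flipBit _ _ _ (by omega),
    show 1 + 3 * k + 1 = 2 + 3 * k by ring,
    kappaBits_flipBit _ _ _ (by rw [length_kappaBits]; omega),
    show 2 + 3 * k + 1 = 3 + 3 * k by ring,
    kappaBits_flipBit _ _ _ (by rw [length_kappaBits, length_kappaBits]; omega),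
    show 3 + 3 * k + 1 = 3 * (k + 1) + 1 by ring]

/-- By density the flip is already defined at binary words of length at least `N`, and every
non-binary word begins with a word of `{0,1}*#`. So `f` and its inverse have depth at most `N`. -/
theorem mem_G31modHash_of_flip {f : BigG31} {j N : ℕ} (hj : j < N)
    (h1 : ∀ x ∈ hashedWords, ∃ y ∈ hashedWords, y ∈ f.map x)
    (h2 : ∀ x ∈ hashedWords, ∃ y ∈ hashedWords, y ∈ f⁻¹.map x)
    (h3 : ∀ b : List Bool, N ≤ b.length → ∀ w,
      bits (flipBit j b) ++ none :: w ∈ f.map (bits b ++ none :: w)) : f ∈ G31modHash := by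
  have h3' : ∀ b : List Bool, N ≤ b.length → ∀ w,
      bits (flipBit j b) ++ none :: w ∈ f⁻¹.map (bits b ++ none :: w) := by
    intro b hb w
    have := h3 (flipBit j b) (by rwa [length_flipBit]) w
    rw [flipBit_flipBit] at this
    exact BigG.mem_inv.2 this
  have key : ∀ f : BigG31, (∀ b : List Bool, N ≤ b.length → ∀ w,
      bits (flipBit j b) ++ none :: w ∈ f.map (bits b ++ none :: w)) →
      ∀ b : List Bool, N ≤ b.length → bits (flipBit j b) ∈ f.map (bits b) := by
    intro f h3 b hb
    refine BigG.mem_of_dense fun v => ?_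
    obtain ⟨β, z, w, hv⟩ := exists_bits_hash v
    have := h3 (b ++ β) (by simp; omega) w
    rw [flipBit_append (by omega)] at this
    exact ⟨z, by simpa [bits_append, hv] using this⟩
  have hdef : ∀ f : BigG31, (∀ x ∈ hashedWords, ∃ y ∈ hashedWords, y ∈ f.map x) →
      (∀ b : List Bool, N ≤ b.length → bits (flipBit j b) ∈ f.map (bits b)) →
      DefinedFrom N f := by
    intro f h1 h3 x hx
    by_cases hB : x ∈ binaryWords
    · obtain ⟨b, rfl⟩ := hB
      exact ⟨_, h3 b (by rwa [length_bits] at hx)⟩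
    · obtain ⟨b, w, rfl⟩ := exists_bits_hash_of_not_binary hB
      obtain ⟨y, -, hy⟩ := h1 (bits b ++ [none]) ⟨b, rfl⟩
      exact ⟨y ++ w, by simpa using f.iso _ _ w hy⟩
  have hG := (hdef f h1 (key f h3)).mem_G31 (hdef _ h2 (key _ h3'))
  refine ⟨mem_G31mod_of_long hG N ?_ ?_, h1, h2⟩
  · rintro _ ⟨b, rfl⟩ hb
    rw [length_bits] at hb
    refine ⟨_, ⟨_, rfl⟩, key f h3 b hb, ?_⟩
    rw [length_bits, length_bits, length_flipBit]
  · rintro _ ⟨b, rfl⟩ hb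
    rw [length_bits] at hb
    exact ⟨_, ⟨_, rfl⟩, key _ h3' b hb⟩

/-- A value at `b` would copy all letters behind `b` unchanged, including the bit at position `j`
that has to be flipped. -/
theorem notMem_domain_of_flip {f : BigG31} {j N : ℕ}
    (h : ∀ b : List Bool, N ≤ b.length → ∀ w,
      bits (flipBit j b) ++ none :: w ∈ f.map (bits b ++ none :: w))
    {b : List Bool} (hb : b.length ≤ j) : bits b ∉ domain f.map := by
  rintro ⟨y, hy⟩
  set e := List.replicate (j - b.length) false with he
  have hj : (b ++ e).length = j := by simp [he]; omega
  -- The zeros `e` bring the next bit to position exactly `j`; the `N` further zeros make the word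
  -- long enough.
  have h1 := h (b ++ e ++ false :: List.replicate N false) (by simp; omega) []
  rw [← hj, flipBit_length_append] at h1
  have h2 := f.iso _ _ (bits e ++ (bits (false :: List.replicate N false) ++ [none])) hy
  have h3 := Option.mem_unique h1 (by simpa [bits_append] using h2)
  have h4 : bits (b ++ e) ++ some true :: (bits (List.replicate N false) ++ [none]) =
      y ++ bits e ++ some false :: (bits (List.replicate N false) ++ [none]) := by
    simpa [bits] using h3
  have h5 := (List.append_inj' h4 (by simp)).2
  simp at h5

/-- The element that flips the second bit. -/
noncomputable def flipSecond : BigG31 :=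
  swap (bits [false, false]) (bits [false, true]) * swap (bits [true, false]) (bits [true, true])

theorem inc_bits_pair {a b c d : Bool} (h : (a, b) ≠ (c, d)) : Inc (bits [a, b]) (bits [c, d]) := by
  refine Inc.of_length_eq rfl fun e => h ?_
  simpa [bits] using e

theorem flipSecond_mem : flipSecond ∈ G31modHash := by
  have h : ∀ a, swap (bits [a, false]) (bits [a, true]) ∈ G31modHash := by
    intro a
    refine swap_mem_G31modHash (Or.inl ⟨_, rfl⟩) (Or.inl ⟨_, rfl⟩) (inc_bits_pair (by simp)) ?_
    rw [color_binary ⟨_, rfl⟩, color_binary ⟨_, rfl⟩]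
    rfl
  exact mul_mem (h false) (h true)

theorem mem_flipSecond {b : List Bool} (hb : 2 ≤ b.length) (w : List Letter) :
    bits (flipBit 1 b) ++ none :: w ∈ flipSecond.map (bits b ++ none :: w) := by
  match b, hb with
  | a :: c :: t, _ =>
    have hi : ∀ a, Inc (bits [a, false]) (bits [a, true]) := fun a => inc_bits_pair (by simp)
    have h0 : bits (a :: c :: t) ++ none :: w = bits [a, c] ++ (bits t ++ none :: w) := rfl
    have h1 : bits (flipBit 1 (a :: c :: t)) ++ none :: w =
      bits [a, !c] ++ (bits t ++ none :: w) := rfl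
    rw [h0, h1]
    have hs : ∀ a, bits [a, !c] ++ (bits t ++ none :: w) ∈
        (swap (bits [a, false]) (bits [a, true])).map (bits [a, c] ++ (bits t ++ none :: w)) := by
      intro a
      cases c
      · exact swap_left (hi a) _
      · exact swap_right (hi a) _
    have hf : ∀ a c, bits [!a, c] ++ (bits t ++ none :: w) ∈
        (swap (bits [a, false]) (bits [a, true])).map (bits [!a, c] ++ (bits t ++ none :: w)) :=
      fun a c => swap_fix (hi a) ((inc_bits_pair (by simp)).append_right _)
        ((inc_bits_pair (by simp)).append_right _)
    cases a
    · exact BigG.mem_mul (hf true c) (hs false)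
    · exact BigG.mem_mul (hs true) (hf false _)

/-- The conjugate of the flip of the second bit by the `n`-th power of `κ_321`. -/
noncomputable def farFlip (n : ℕ) : BigG31 := kappa321 ^ n * flipSecond * (kappa321 ^ n)⁻¹

/-- `κ_321` permutes `{0,1}*#`, short words included, so conjugates remain defined there although
the flip is described only on long words. -/
theorem exists_hashed_conj {f : BigG31}
    (h : ∀ x ∈ hashedWords, ∃ y ∈ hashedWords, y ∈ f.map x) (n : ℕ) :
    ∀ x ∈ hashedWords, ∃ y ∈ hashedWords, y ∈ (kappa321 ^ n * f * (kappa321 ^ n)⁻¹).map x := by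
  induction n with
  | zero => simpa using h
  | succ n ih =>
    rintro _ ⟨b, rfl⟩
    obtain ⟨c, -, rfl⟩ := exists_kappa321Bits_eq b
    obtain ⟨_, ⟨d, rfl⟩, hd⟩ := ih (bits c ++ [none]) ⟨c, rfl⟩
    refine ⟨_, ⟨kappa321Bits d, rfl⟩, ?_⟩
    have e : kappa321 ^ (n + 1) * f * (kappa321 ^ (n + 1))⁻¹ =
        kappa321 * ((kappa321 ^ n * f * (kappa321 ^ n)⁻¹) * kappa321⁻¹) := by
      rw [pow_succ']
      group
    rw [e]
    exact BigG.mem_mul (BigG.mem_mul (BigG.mem_inv.2 (mem_kappa321 c [])) hd) (mem_kappa321 d [])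

theorem mem_farFlip (n : ℕ) (b : List Bool) (hb : 3 * n + 6 ≤ b.length) (w : List Letter) :
    bits (flipBit (3 * n + 1) b) ++ none :: w ∈ (farFlip n).map (bits b ++ none :: w) := by
  induction n generalizing b with
  | zero => simpa [farFlip] using mem_flipSecond (by omega) w
  | succ n ih =>
    obtain ⟨c, hc, rfl⟩ := exists_kappa321Bits_eq b
    have e : farFlip (n + 1) = kappa321 * (farFlip n * kappa321⁻¹) := by
      rw [farFlip, farFlip, pow_succ']
      group
    rw [e, ← kappa321Bits_flipBit _ _ (by omega)]
    exact BigG.mem_mul (BigG.mem_mul (BigG.mem_inv.2 (mem_kappa321 c w)) (ih c (by omega)))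
      (mem_kappa321 _ w)

theorem farFlip_mem (n : ℕ) : farFlip n ∈ G31modHash := by
  refine mem_G31modHash_of_flip (j := 3 * n + 1) (N := 3 * n + 6) (by omega)
    (exists_hashed_conj flipSecond_mem.2.1 n) ?_ (mem_farFlip n)
  have : (farFlip n)⁻¹ = kappa321 ^ n * flipSecond⁻¹ * (kappa321 ^ n)⁻¹ := by
    rw [farFlip]
    group
  rw [this]
  exact exists_hashed_conj flipSecond_mem.2.2 n

/-! ### Counting undefined words -/

/-- `f` belongs to the Thompson-Higman group and is undefined at no more than `c` words. -/
def UndefinedLE (c : ℕ) (f : BigG31) : Prop :=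
  f ∈ G31 ∧ (domain f.map)ᶜ.ncard ≤ c

theorem finite_undefined {f : BigG31} (hf : f ∈ G31) : (domain f.map)ᶜ.Finite := by
  obtain ⟨D, hD, -⟩ := exists_definedFrom hf
  refine (List.finite_length_lt Letter D).subset fun x hx => ?_
  by_contra h
  exact hx (hD x (not_lt.1 h))

theorem UndefinedLE.mul {c d : ℕ} {f g : BigG31} (hf : UndefinedLE c f) (hg : UndefinedLE d g) :
    UndefinedLE (c + d) (f * g) := by
  refine ⟨mul_mem hf.1 hg.1, ?_⟩
  set U := (domain f.map)ᶜ with hU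
  -- Where the product is undefined, either `g` is undefined or its value is an undefined word of
  -- `f`, which has one preimage. The default value `[]` only enlarges the right side.
  have hsub : (domain (f * g).map)ᶜ ⊆
      (domain g.map)ᶜ ∪ (fun y => (g⁻¹.map y).getD []) '' U := by
    intro x hx
    by_cases h : x ∈ domain g.map
    · obtain ⟨y, hy⟩ := h
      refine Or.inr ⟨y, fun ⟨z, hz⟩ => hx ⟨z, BigG.mem_mul hy hz⟩, ?_⟩
      have : g⁻¹.map y = some x := BigG.mem_inv.2 hy
      simp [this]
    · exact Or.inl h
  have h1 := finite_undefined hf.1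
  have h2 := finite_undefined hg.1
  calc _ ≤ _ := Set.ncard_le_ncard hsub (h2.union (h1.image _))
    _ ≤ _ := Set.ncard_union_le _ _
    _ ≤ d + c := add_le_add hg.2 ((Set.ncard_image_le h1).trans hf.2)
    _ = c + d := add_comm _ _

theorem UndefinedLE.one : UndefinedLE 0 1 := by
  refine ⟨one_mem _, ?_⟩
  have : (domain (1 : BigG31).map)ᶜ = ∅ := by
    rw [Set.compl_empty_iff, Set.eq_univ_iff_forall]
    exact fun x => ⟨x, BigG.mem_one.2 rfl⟩
  rw [this, Set.ncard_empty]

theorem two_pow_le_of_undefinedLE {n c : ℕ} (h : UndefinedLE c (farFlip n)) : 2 ^ n ≤ c := by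
  refine le_trans ?_ h.2
  have hinj : Function.Injective fun v : List.Vector Bool n => bits v.1 := by
    intro v w hvw
    exact Subtype.ext (List.map_injective_iff.2 (Option.some_injective _) hvw)
  have hcard : (Set.range fun v : List.Vector Bool n => bits v.1).ncard = 2 ^ n := by
    rw [← Set.image_univ, Set.ncard_image_of_injective _ hinj, Set.ncard_univ,
      Nat.card_eq_fintype_card, card_vector, Fintype.card_bool]
  rw [← hcard]
  refine Set.ncard_le_ncard ?_ (finite_undefined h.1)
  rintro _ ⟨v, rfl⟩
  -- The binary words of length `n` suffice, since `n ≤ 3n+1`.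
  exact notMem_domain_of_flip (mem_farFlip n) (by rw [v.2]; omega)

/-- The word length in a subgroup of the Thompson-Higman group is bounded below by a multiple of
the number of words at which an element is undefined. -/
theorem exists_two_pow_le {S : Set BigG31} (hS : S.Finite) (h : S ⊆ G31) :
    ∃ c, ∀ n k, WordOn S k (farFlip n) → 2 ^ n ≤ c * k := by
  obtain ⟨c, hc⟩ := exists_uniform_bound hS (P := fun c f => UndefinedLE c f ∧ UndefinedLE c f⁻¹)
    (fun a b x hx hab => ⟨⟨hx.1.1, hx.1.2.trans hab⟩, ⟨hx.2.1, hx.2.2.trans hab⟩⟩)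
    (fun s hs => ⟨(domain s.map)ᶜ.ncard + (domain s⁻¹.map)ᶜ.ncard, ⟨h hs, by omega⟩,
      ⟨inv_mem (h hs), by omega⟩⟩)
  exact ⟨c, fun n k hk => two_pow_le_of_undefinedLE (WordOn.induction (P := UndefinedLE) .one
    (fun a b x y hx hy => hx.mul hy) hc (fun a b x hx hab => ⟨hx.1, hx.2.trans hab⟩) hk)⟩

/-! ### Assembly of the two bounds -/

theorem Coloring.exponentialDistortion {H K : Subgroup BigG31} {Inn Adm : Set (List Letter)}
    {τ : List Letter → ℕ} (hc : Coloring H Inn Adm τ) (hHash : G31modHash ≤ H) (hHK : H ≤ K)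
    (hK : K.FG) (hKle : K ≤ adjoinKappa G31) (hκ : kappa321 ∈ K) : ExponentialDistortion H K := by
  refine ⟨hHK, (Subgroup.fg_iff _).2 ⟨_, hc.closure_swapSet, swapSet_finite _ _ _⟩, hK, ?_⟩
  intro S T hS hT hSH hTK
  obtain ⟨c, hdepth⟩ := exists_linear_depth hT
    ((Subgroup.subset_closure (k := T)).trans (by rw [hTK]; exact hKle))
  obtain ⟨d, hd⟩ := exists_wordOn_of_finite (S := swapSet Adm τ 7) (T := S)
    (swapSet_finite _ _ _) (by rw [hSH]; exact hc.swapSet_subset 7)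
  -- Linear depth `c * n`, then exponentially many exchanges, then a change of generators with
  -- factor `d`. The base 9 is replaced by `2 ^ 4`; the added ones keep the constants positive.
  have hup : ∀ n, ∀ g ∈ Subgroup.closure S, wordLength T g ≤ n →
      wordLength S g ≤ (25 * d + 1) * 2 ^ ((4 * c + 1) * n) := by
    intro n g hg hn
    rw [hSH] at hg
    have hgT : g ∈ Subgroup.closure T := hTK ▸ hHK hg
    obtain ⟨h1, h2⟩ := hdepth n g ((wordOn_wordLength hgT).mono hn) (hc.le_G31 hg)
    refine (hd _ _ (hc.wordOn_of_definedFrom hg h1 h2)).wordLength_le.trans ?_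
    calc d * (25 * 9 ^ (c * n)) = 25 * d * 9 ^ (c * n) := by ring
      _ ≤ (25 * d + 1) * (2 ^ 4) ^ (c * n) := by gcongr <;> omega
      _ = (25 * d + 1) * 2 ^ (4 * (c * n)) := by rw [← pow_mul]
      _ ≤ _ := by
        refine Nat.mul_le_mul_left _ (Nat.pow_le_pow_right (by norm_num) ?_)
        rw [add_mul, mul_assoc]
        omega
  -- Without boundedness the supremum in `distortion` would take the default value 0, and the lower
  -- bound could not be read off from `farFlip n`.
  have hbdd : ∀ n, BddAbove {m | ∃ g ∈ Subgroup.closure S, wordLength T g ≤ n ∧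
      wordLength S g = m} := by
    intro n
    refine ⟨(25 * d + 1) * 2 ^ ((4 * c + 1) * n), ?_⟩
    rintro m ⟨g, hg, hn, rfl⟩
    exact hup n g hg hn
  obtain ⟨e, he⟩ := exists_two_pow_le hS
    ((Subgroup.subset_closure (k := S)).trans (by rw [hSH]; exact hc.le_G31))
  obtain ⟨a, ha⟩ := exists_wordOn (S := T) (g := kappa321) (by rwa [hTK])
  obtain ⟨b, hb⟩ := exists_wordOn (S := T) (g := flipSecond)
    (by rw [hTK]; exact hHK (hHash flipSecond_mem))
  refine ⟨1, 25 * d + 1, 4 * c + 1, e + 1, 2 * a + b + 1, by omega, by omega, by omega, by omega,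
    by omega, fun n hn => ⟨?_, ?_⟩⟩
  · refine csSup_le' ?_
    rintro m ⟨g, hg, hgn, rfl⟩
    exact hup n g hg hgn
  · have hS' : farFlip n ∈ Subgroup.closure S := by
      rw [hSH]
      exact hHash (farFlip_mem n)
    have h1 := he n _ (wordOn_wordLength hS')
    have h2 : WordOn T (n * a + b + n * a) (farFlip n) := ((ha.pow n).mul hb).mul (ha.pow n).inv
    have h3 : wordLength T (farFlip n) ≤ (2 * a + b + 1) * n := by
      refine h2.wordLength_le.trans ?_
      -- Here `n ≥ 1` absorbs the constant `b`.
      nlinarith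
    have h4 : wordLength S (farFlip n) ≤ distortion S T ((2 * a + b + 1) * n) :=
      le_csSup (hbdd _) ⟨_, hS', h3, rfl⟩
    exact h1.trans (Nat.mul_le_mul (by omega) h4)

theorem adjoinKappa_fg {H : Subgroup BigG31} (hH : H.FG) : (adjoinKappa H).FG := by
  obtain ⟨S, hS, hfin⟩ := (Subgroup.fg_iff _).1 hH
  refine (Subgroup.fg_iff _).2 ⟨S ∪ {kappa321}, ?_, hfin.union (Set.finite_singleton _)⟩
  rw [adjoinKappa, Subgroup.closure_union, Subgroup.closure_union, hS, Subgroup.closure_eq]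

theorem le_adjoinKappa (H : Subgroup BigG31) : H ≤ adjoinKappa H :=
  fun _ h => Subgroup.subset_closure (Or.inl h)

theorem adjoinKappa_mono {H K : Subgroup BigG31} (h : H ≤ K) : adjoinKappa H ≤ adjoinKappa K :=
  Subgroup.closure_mono (Set.union_subset_union_left _ h)

theorem kappa321_mem_adjoinKappa (H : Subgroup BigG31) : kappa321 ∈ adjoinKappa H :=
  Subgroup.subset_closure (Or.inr rfl)

/-- A finitely generated group between `G_{3,1}^{mod 3}(0,1;#)` and `G_{3,1}` with colours is
exponentially distorted in every group obtained from a larger such group by adjoining `κ_321`. -/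
theorem Coloring.exponentialDistortion_adjoinKappa {H K : Subgroup BigG31}
    {Inn Adm Inn' Adm' : Set (List Letter)} {τ τ' : List Letter → ℕ} (hH : Coloring H Inn Adm τ)
    (hK : Coloring K Inn' Adm' τ') (hHash : G31modHash ≤ H) (hHK : H ≤ K) :
    ExponentialDistortion H (adjoinKappa K) :=
  hH.exponentialDistortion hHash (hHK.trans (le_adjoinKappa K))
    (adjoinKappa_fg ((Subgroup.fg_iff _).2 ⟨_, hK.closure_swapSet, swapSet_finite _ _ _⟩))
    (adjoinKappa_mono hK.le_G31) (kappa321_mem_adjoinKappa K)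

end BigThompson

theorem mainTheorem7 :
    BigThompson.ExponentialDistortion BigThompson.G31
        (BigThompson.adjoinKappa BigThompson.G31) ∧
      BigThompson.ExponentialDistortion BigThompson.G31mod BigThompson.H01 ∧
      BigThompson.ExponentialDistortion BigThompson.G31mod
        (BigThompson.adjoinKappa BigThompson.G31) ∧
      BigThompson.ExponentialDistortion BigThompson.G31modHash BigThompson.H01Hash ∧
      BigThompson.ExponentialDistortion BigThompson.G31modHash BigThompson.H01 ∧
      BigThompson.ExponentialDistortion BigThompson.G31modHash
        (BigThompson.adjoinKappa BigThompson.G31) := by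
  have h1 := BigThompson.coloring_G31
  have h2 := BigThompson.coloring_G31mod
  have h3 := BigThompson.coloring_G31modHash
  have h32 : BigThompson.G31modHash ≤ BigThompson.G31mod := fun _ h => h.1
  exact ⟨h1.exponentialDistortion_adjoinKappa h1 h3.le_G31 le_rfl,
    h2.exponentialDistortion_adjoinKappa h2 h32 le_rfl,
    h2.exponentialDistortion_adjoinKappa h1 h32 h2.le_G31,
    h3.exponentialDistortion_adjoinKappa h3 le_rfl le_rfl,
    h3.exponentialDistortion_adjoinKappa h2 le_rfl h32,
    h3.exponentialDistortion_adjoinKappa h1 le_rfl h3.le_G31⟩
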